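/- Let $n\ge 1$ be an integer and let $a<b$ be real numbers. Let $\mathcal A_c$ be the space of distributions $T$ on $(a,b)$ of the form $T=F'$ (distributional derivative) with $F\in C([a,b])$, $F(a)=0$; the primitive $F$ is unique, and one writes $\int_a^xT=F(x)$. The Alexiewicz norm of $T$ is $\|T\|=\sup_{a\le x\le b}\left|\int_a^xT\right|$, and for $g$ of bounded variation $\int_a^bT\,g=F(b)g(b)-F(a)g(a)-\int_a^bF\,dg$ (Riemann–Stieltjes integral). Let $T_n$ be the Chebyshev polynomial of the first kind, put $\tilde\phi_n=2^{1-n}(T_n-1)$ and $$\phi_n(x)=\left(\frac{b-a}{2}\right)^n\tilde\phi_n\!\left(\frac{2x-a-b}{b-a}\right).$$ (i) The polynomial $\phi_n$ is monic of degree $n$, and it is the unique minimizer of $|\phi(b)|+V_{[a,b]}\phi$ among the monic real polynomials $\phi$ of degree $n$, where $V_{[a,b]}\phi$ is the total variation of $\phi$ on $[a,b]$. (ii) Let $f:[a,b]\to\mathbb R$ be such that the pointwise derivative $f^{(n-1)}$ exists and is continuous on $[a,b]$ (one-sided derivatives at the end points). Then the $n$-th distributional derivative $f^{(n)}$ lies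 in $\mathcal A_c$, the integral in $$E_n(f)=\frac{(-1)^n}{n!}\int_a^bf^{(n)}\phi_n$$ exists, $$\int_a^bf(x)\,dx=\frac1{(n-1)!}\sum_{k=0}^{n-2}\frac{(b-a)^{k+1}(2n-k-2)!\,(n-k-1)!}{2^{2k+1}(2n-2k-2)!\,(k+1)!}\left[f^{(k)}(a)+(-1)^kf^{(k)}(b)\right]+R_n(f)+E_n(f),$$ where $R_n(f)=\dfrac{(b-a)^nf^{(n-1)}(a)}{n!\,2^{2n-2}}$ if $n$ is odd and $R_n(f)=0$ if $n$ is even, and $$|E_n(f)|\le\frac{\|f^{(n)}\|\,(b-a)^n}{(n-1)!\,2^{2n-2}}.$$ (iii) The coefficient of $\|f^{(n)}\|$ in this estimate is sharp: if $c\in\mathbb R$ is such that $|E_n(f)|\le c\,\|f^{(n)}\|$ for all $f$ as in (ii), then $c\ge\dfrac{(b-a)^n}{(n-1)!\,2^{2n-2}}$. -/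

import Mathlib

noncomputable section

namespace CPI

open Set MeasureTheory TopologicalSpace Polynomial
open scoped Distributions Nat LineDeriv

/-- The open interval `(a, b)` as an open subset of `ℝ`. -/
def openInterval (a b : ℝ) : Opens ℝ := ⟨Ioo a b, isOpen_Ioo⟩

/-- The distribution `φ ↦ ∫ φ(x) f(x) dx` on `(a, b)` given by a function `f` that is locally
integrable on `(a, b)`. -/
def ofFun (a b : ℝ) (f : ℝ → ℝ) : 𝓓'(openInterval a b, ℝ) :=
  ContinuousLinearMap.toUniformConvergenceCLM (RingHom.id ℝ) ℝ _
    (TestFunction.integralAgainstBilinCLM (ContinuousLinearMap.mul ℝ ℝ) volume f)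

/-- The distributional derivative, `⟨T', φ⟩ = -⟨T, φ'⟩`. -/
def distDeriv {a b : ℝ} (T : 𝓓'(openInterval a b, ℝ)) : 𝓓'(openInterval a b, ℝ) :=
  ∂_{(1 : ℝ)} T

/-- The `n`-th distributional derivative on `(a, b)` of a function on `[a, b]`. -/
def distDerivFun (n : ℕ) (a b : ℝ) (f : ℝ → ℝ) : 𝓓'(openInterval a b, ℝ) :=
  distDeriv^[n] (ofFun a b f)

/-- `F` is a continuous function on `[a, b]` with `F(a) = 0` whose distributional derivative
is `T`. -/
def IsPrimitive {a b : ℝ} (F : ℝ → ℝ) (T : 𝓓'(openInterval a b, ℝ)) : Prop :=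
  ContinuousOn F (Icc a b) ∧ F a = 0 ∧ distDeriv (ofFun a b F) = T

/-- The space `𝒜_c` of distributions on `(a, b)` that are integrable in the sense of the continuous
primitive integral. -/
def Ac (a b : ℝ) : Set 𝓓'(openInterval a b, ℝ) :=
  {T | ∃ F : ℝ → ℝ, IsPrimitive F T}

open Classical in
/-- The continuous primitive integral `x ↦ ∫_a^x T`, that is, the primitive of `T` (unique on
`[a, b]`); a junk value if `T ∉ 𝒜_c`. -/
def cpIntegral {a b : ℝ} (T : 𝓓'(openInterval a b, ℝ)) : ℝ → ℝ :=
  if h : ∃ F : ℝ → ℝ, IsPrimitive F T then h.choose else 0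

/-- The Alexiewicz norm `sup_{a ≤ x ≤ b} |∫_a^x T|`. -/
def alexNorm {a b : ℝ} (T : 𝓓'(openInterval a b, ℝ)) : ℝ :=
  sSup ((fun x => |cpIntegral T x|) '' Icc a b)

/-- `I` is the Riemann–Stieltjes integral `∫_a^b F dg`: the limit of the sums over tagged
partitions of `[a, b]` as the mesh tends to zero. -/
def HasRSIntegral (a b : ℝ) (F g : ℝ → ℝ) (I : ℝ) : Prop :=
  ∀ ε > 0, ∃ δ > 0, ∀ (N : ℕ) (x t : ℕ → ℝ), Monotone x → x 0 = a → x N = b →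
    (∀ i < N, x (i + 1) - x i < δ) → (∀ i < N, t i ∈ Icc (x i) (x (i + 1))) →
    |∑ i ∈ Finset.range N, F (t i) * (g (x (i + 1)) - g (x i)) - I| < ε

/-- `I` is the continuous primitive integral `∫_a^b T g`, defined by integration by parts:
`I = F(b) g(b) - F(a) g(a) - ∫_a^b F dg` with `F` the primitive of `T`. -/
def HasCPIntegralMul {a b : ℝ} (T : 𝓓'(openInterval a b, ℝ)) (g : ℝ → ℝ) (I : ℝ) : Prop :=
  ∃ F : ℝ → ℝ, IsPrimitive F T ∧
    ∃ J : ℝ, HasRSIntegral a b F g J ∧ I = F b * g b - F a * g a - J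

open Classical in
/-- The value of `∫_a^b T g`; a junk value if this integral does not exist. -/
def cpIntegralMul {a b : ℝ} (T : 𝓓'(openInterval a b, ℝ)) (g : ℝ → ℝ) : ℝ :=
  if h : ∃ I : ℝ, HasCPIntegralMul T g I then h.choose else 0

/-- The polynomial `2^{1-n} (T_n - 1)` on `[-1, 1]`. -/
def minPoly (n : ℕ) : ℝ[X] :=
  C ((2 : ℝ) ^ (1 - (n : ℤ))) * (Chebyshev.T ℝ n - 1)

/-- Its transplant `((b-a)/2)^n · 2^{1-n} (T_n((2x-a-b)/(b-a)) - 1)` to `[a, b]`. -/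
def minPolyOn (n : ℕ) (a b : ℝ) : ℝ[X] :=
  C (((b - a) / 2) ^ n) *
    (minPoly n).comp (C (2 / (b - a)) * X - C ((a + b) / (b - a)))

/-- The factor `|p(b)| + Vp` of the Hölder inequality, with `Vp` the variation of `p` on
`[a, b]`. -/
def holderFactor (a b : ℝ) (p : ℝ[X]) : ENNReal :=
  ENNReal.ofReal |p.eval b| + eVariationOn (fun x => p.eval x) (Icc a b)

/-- The quadrature rule. The derivatives of `f` are taken within `[a, b]`, so one-sided at the
end points. -/
def quadRule (n : ℕ) (a b : ℝ) (f : ℝ → ℝ) : ℝ :=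
  1 / ((n - 1)! : ℝ) * ∑ k ∈ Finset.range (n - 1),
      ((b - a) ^ (k + 1) * ((2 * n - k - 2)! : ℝ) * ((n - k - 1)! : ℝ) /
        (2 ^ (2 * k + 1) * ((2 * n - 2 * k - 2)! : ℝ) * ((k + 1)! : ℝ))) *
      (iteratedDerivWithin k f (Icc a b) a + (-1) ^ k * iteratedDerivWithin k f (Icc a b) b)
  + if Odd n then
      (b - a) ^ n * iteratedDerivWithin (n - 1) f (Icc a b) a / ((n ! : ℝ) * 2 ^ (2 * n - 2))
    else 0

/-- The error `E_n(f) = ((-1)^n / n!) ∫_a^b f^{(n)} φ_n` as a continuous primitive integral. -/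
def quadError (n : ℕ) (a b : ℝ) (f : ℝ → ℝ) : ℝ :=
  (-1) ^ n / (n ! : ℝ) *
    cpIntegralMul (distDerivFun n a b f) (fun x => (minPolyOn n a b).eval x)

end CPI

end

/-!
The total variation of a polynomial `p` on `[a, b]` is `∫ |p'|`. On the `n + 1` extremal points of
`φ_n` the alternating sum of the increments of a monic `p` of degree `n` depends only on `n`, `a`
and `b`, and it is at most `∫ |p'|`, with equality only if `p'` changes sign exactly where `φ_n'`
does. Hence `|p(b)| + ∫ |p'|` is minimal only if `p' = φ_n'` and `p(b) = 0`, that is, `p = φ_n`.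

The quadrature formula is repeated integration by parts against `φ_n`, whose derivatives at the two
end points agree up to sign. The error estimate is the Hölder inequality
`|∫ T g| ≤ ‖T‖ (|g(b)| + V g)`, and it is sharp because the sign of `φ_n'` is approximated in `L¹`
by continuous primitives that are bounded by `1` and vanish at `a`.
-/

noncomputable section

namespace CPI

open Set MeasureTheory TopologicalSpace Polynomial
open scoped Distributions Nat LineDeriv

section Calculus

variable {a b : ℝ} {f f' : ℝ → ℝ}

lemma integral_eq_sub_of_hasDerivWithinAt_Icc
    (hf : ∀ x ∈ Icc a b, HasDerivWithinAt f (f' x) (Icc a b) x) (hf' : ContinuousOn f' (Icc a b))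
    {c d : ℝ} (hc : c ∈ Icc a b) (hd : d ∈ Icc a b) :
    ∫ x in c..d, f' x = f d - f c := by
  have hcd : uIcc c d ⊆ Icc a b := ordConnected_Icc.uIcc_subset hc hd
  refine intervalIntegral.integral_eq_sub_of_hasDeriv_right
    (fun x hx => ((hf x (hcd hx)).continuousWithinAt).mono hcd) (fun x hx => ?_)
    (hf'.mono hcd).intervalIntegrable
  have hx' : x ∈ Ioo a b :=
    ⟨(le_min hc.1 hd.1).trans_lt hx.1, hx.2.trans_le (max_le hc.2 hd.2)⟩
  exact ((hf x (Ioo_subset_Icc_self hx')).hasDerivAt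
    (Icc_mem_nhds hx'.1 hx'.2)).hasDerivWithinAt

lemma edist_le_ofReal_integral_abs
    (hf : ∀ x ∈ Icc a b, HasDerivWithinAt f (f' x) (Icc a b) x) (hf' : ContinuousOn f' (Icc a b))
    {c d : ℝ} (hc : c ∈ Icc a b) (hd : d ∈ Icc a b) (hcd : c ≤ d) :
    edist (f d) (f c) ≤ ENNReal.ofReal (∫ x in c..d, |f' x|) := by
  rw [edist_dist, Real.dist_eq, ← integral_eq_sub_of_hasDerivWithinAt_Icc hf hf' hc hd]
  exact ENNReal.ofReal_le_ofReal (intervalIntegral.abs_integral_le_integral_abs hcd)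

lemma eVariationOn_le_ofReal_integral_abs
    (hf : ∀ x ∈ Icc a b, HasDerivWithinAt f (f' x) (Icc a b) x) (hf' : ContinuousOn f' (Icc a b)) :
    eVariationOn f (Icc a b) ≤ ENNReal.ofReal (∫ x in a..b, |f' x|) := by
  refine iSup_le fun ⟨n, u, hu, hmem⟩ => ?_
  have hint : ∀ k < n, IntervalIntegrable (fun x => |f' x|) volume (u k) (u (k + 1)) := fun k _ =>
    (hf'.abs.mono (ordConnected_Icc.uIcc_subset (hmem k) (hmem (k + 1)))).intervalIntegrable
  calc ∑ k ∈ Finset.range n, edist (f (u (k + 1))) (f (u k))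
      ≤ ∑ k ∈ Finset.range n, ENNReal.ofReal (∫ x in u k..u (k + 1), |f' x|) :=
        Finset.sum_le_sum fun k _ =>
          edist_le_ofReal_integral_abs hf hf' (hmem k) (hmem (k + 1)) (hu k.le_succ)
    _ = ENNReal.ofReal (∫ x in u 0..u n, |f' x|) := by
        rw [← ENNReal.ofReal_sum_of_nonneg fun k _ =>
          intervalIntegral.integral_nonneg (hu k.le_succ) fun _ _ => abs_nonneg _,
          intervalIntegral.sum_integral_adjacent_intervals hint]
    _ ≤ ENNReal.ofReal (∫ x in a..b, |f' x|) :=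
        ENNReal.ofReal_le_ofReal <| intervalIntegral.integral_mono_interval (hmem 0).1
          (hu n.zero_le) (hmem n).2 (Filter.Eventually.of_forall fun _ => abs_nonneg _)
          (hf'.abs.intervalIntegrable_of_Icc ((hmem 0).1.trans (hmem 0).2))

lemma integral_eq_integral_abs_iff (hab : a < b) (hf : ContinuousOn f (Icc a b)) :
    ∫ x in a..b, f x = ∫ x in a..b, |f x| ↔ ∀ x ∈ Icc a b, 0 ≤ f x := by
  refine ⟨fun h x hx => ?_, fun h => intervalIntegral.integral_congr fun x hx => ?_⟩
  · by_contra! hneg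
    exact h.not_lt <|
      intervalIntegral.integral_lt_integral_of_continuousOn_of_le_of_exists_lt hab hf hf.abs
        (fun _ _ => le_abs_self _) ⟨x, hx, hneg.trans_le (abs_nonneg _)⟩
  · exact (abs_of_nonneg (h x (uIcc_of_le hab.le ▸ hx))).symm

end Calculus

section AlternatingSum

/-- The linear functional `u ↦ ∑_{k < n} (-1)^k (u k - u (k + 1))`. On the values of an oscillating
function at its successive extrema, listed from right to left, it is the total variation. -/
def alternatingSum (n : ℕ) : (ℕ → ℝ) →ₗ[ℝ] ℝ :=
  ∑ k ∈ Finset.range n, (-1 : ℝ) ^ k •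
    ((LinearMap.proj k : (ℕ → ℝ) →ₗ[ℝ] ℝ) - LinearMap.proj (k + 1))

lemma alternatingSum_apply (n : ℕ) (u : ℕ → ℝ) :
    alternatingSum n u = ∑ k ∈ Finset.range n, (-1) ^ k * (u k - u (k + 1)) := by
  simp [alternatingSum]

lemma alternatingSum_congr {n : ℕ} {u v : ℕ → ℝ} (h : ∀ k ≤ n, u k = v k) :
    alternatingSum n u = alternatingSum n v := by
  simp only [alternatingSum_apply]
  refine Finset.sum_congr rfl fun k hk => ?_
  rw [h k (Finset.mem_range.1 hk).le, h (k + 1) (Finset.mem_range.1 hk)]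

variable {a b : ℝ} {f f' : ℝ → ℝ} {n : ℕ} {y : ℕ → ℝ}

lemma alternatingSum_comp_eq_sum_integral
    (hf : ∀ x ∈ Icc a b, HasDerivWithinAt f (f' x) (Icc a b) x) (hf' : ContinuousOn f' (Icc a b))
    (hmem : ∀ k ≤ n, y k ∈ Icc a b) :
    alternatingSum n (f ∘ y) =
      ∑ k ∈ Finset.range n, ∫ x in y (k + 1)..y k, (-1) ^ k * f' x := by
  rw [alternatingSum_apply]
  refine Finset.sum_congr rfl fun k hk => ?_
  rw [Finset.mem_range] at hk
  rw [intervalIntegral.integral_const_mul,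
    integral_eq_sub_of_hasDerivWithinAt_Icc hf hf' (hmem _ hk) (hmem _ hk.le)]
  rfl

lemma integral_abs_eq_sum_integral_abs (hf' : ContinuousOn f' (Icc a b))
    (hmem : ∀ k ≤ n, y k ∈ Icc a b) :
    ∫ x in y n..y 0, |f' x| =
      ∑ k ∈ Finset.range n, ∫ x in y (k + 1)..y k, |(-1) ^ k * f' x| := by
  have hint : ∀ k < n, IntervalIntegrable (fun x => |f' x|) volume (y k) (y (k + 1)) :=
    fun k hk => (hf'.abs.mono (ordConnected_Icc.uIcc_subset (hmem k hk.le)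
      (hmem (k + 1) hk))).intervalIntegrable
  rw [intervalIntegral.integral_symm, ← intervalIntegral.sum_integral_adjacent_intervals hint,
    ← Finset.sum_neg_distrib]
  exact Finset.sum_congr rfl fun k _ => by
    simp [← intervalIntegral.integral_symm, abs_mul]

lemma integral_le_integral_abs_of_antitoneOn (hy : AntitoneOn y (Iic n)) (f' : ℝ → ℝ) :
    ∀ k ∈ Finset.range n, ∫ x in y (k + 1)..y k, (-1) ^ k * f' x ≤
      ∫ x in y (k + 1)..y k, |(-1) ^ k * f' x| := fun k hk => by
  rw [Finset.mem_range] at hk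
  exact (le_abs_self _).trans <|
    intervalIntegral.abs_integral_le_integral_abs (hy hk.le hk k.le_succ)

lemma alternatingSum_comp_le_integral_abs
    (hf : ∀ x ∈ Icc a b, HasDerivWithinAt f (f' x) (Icc a b) x) (hf' : ContinuousOn f' (Icc a b))
    (hmem : ∀ k ≤ n, y k ∈ Icc a b) (hy : AntitoneOn y (Iic n)) :
    alternatingSum n (f ∘ y) ≤ ∫ x in y n..y 0, |f' x| := by
  rw [alternatingSum_comp_eq_sum_integral hf hf' hmem, integral_abs_eq_sum_integral_abs hf' hmem]
  exact Finset.sum_le_sum (integral_le_integral_abs_of_antitoneOn hy f')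

lemma alternatingSum_comp_eq_integral_abs_iff
    (hf : ∀ x ∈ Icc a b, HasDerivWithinAt f (f' x) (Icc a b) x) (hf' : ContinuousOn f' (Icc a b))
    (hmem : ∀ k ≤ n, y k ∈ Icc a b) (hy : StrictAntiOn y (Iic n)) :
    alternatingSum n (f ∘ y) = ∫ x in y n..y 0, |f' x| ↔
      ∀ k < n, ∀ x ∈ Icc (y (k + 1)) (y k), 0 ≤ (-1) ^ k * f' x := by
  rw [alternatingSum_comp_eq_sum_integral hf hf' hmem, integral_abs_eq_sum_integral_abs hf' hmem,
    Finset.sum_eq_sum_iff_of_le (integral_le_integral_abs_of_antitoneOn hy.antitoneOn f')]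
  refine forall_congr' fun k => ?_
  rw [Finset.mem_range]
  refine forall_congr' fun hk => ?_
  exact integral_eq_integral_abs_iff (hy hk.le hk k.lt_succ_self)
    (continuousOn_const.mul (hf'.mono (Icc_subset_Icc (hmem _ hk).1 (hmem _ hk.le).2)))

end AlternatingSum

section ChebyshevNodes

open Polynomial.Chebyshev

lemma sin_half_mul_sum_cos (β : ℝ) (n : ℕ) :
    Real.sin (β / 2) * ∑ k ∈ Finset.range n, (Real.cos (k * β) + Real.cos ((k + 1 : ℕ) * β)) =
      Real.cos (β / 2) * Real.sin (n * β) := by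
  induction n with
  | zero => simp
  | succ n ih =>
    have harg : ((n + 1 : ℕ) : ℝ) * β = n * β + 2 * (β / 2) := by push_cast; ring
    rw [Finset.sum_range_succ, mul_add, ih, harg, Real.cos_add, Real.sin_add, Real.sin_two_mul,
      Real.cos_two_mul]
    linear_combination
      (-2 * Real.sin (n * β) * Real.cos (β / 2)) * Real.sin_sq_add_cos_sq (β / 2)

lemma alternatingSum_eval_T_node_eq_zero {m n : ℕ} (hmn : m < n) :
    alternatingSum n (fun k => (T ℝ m).eval (node n k)) = 0 := by
  have hn : (0 : ℝ) < n := by exact_mod_cast m.zero_le.trans_lt hmn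
  -- Shifting the frequency by `π` absorbs the alternating signs.
  set β : ℝ := m * Real.pi / n + Real.pi with hβ
  have hT (k : ℕ) : (T ℝ m).eval (node n k) = (-1) ^ k * Real.cos (k * β) := by
    have harg : k * β = m * (k * Real.pi / n) + k * Real.pi := by rw [hβ]; ring
    rw [harg, Real.cos_add_nat_mul_pi, ← mul_assoc, ← mul_pow, neg_one_mul, neg_neg, one_pow,
      one_mul, node, T_real_cos, Int.cast_natCast]
  have hsum : alternatingSum n (fun k => (T ℝ m).eval (node n k)) =
      ∑ k ∈ Finset.range n, (Real.cos (k * β) + Real.cos ((k + 1 : ℕ) * β)) := by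
    rw [alternatingSum_apply]
    refine Finset.sum_congr rfl fun k _ => ?_
    rw [hT, hT, pow_succ]
    linear_combination (Real.cos (k * β) + Real.cos ((k + 1 : ℕ) * β)) *
      (Even.neg_one_pow (Even.add_self k) : (-1 : ℝ) ^ (k + k) = 1)
  have hsin : Real.sin (n * β) = 0 := by
    have harg : n * β = ((m + n : ℕ) : ℝ) * Real.pi := by rw [hβ]; push_cast; field_simp
    rw [harg, Real.sin_nat_mul_pi]
  have hlt : m * Real.pi / n < Real.pi := by
    rw [div_lt_iff₀ hn, mul_comm]
    exact mul_lt_mul_of_pos_left (by exact_mod_cast hmn) Real.pi_pos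
  have hpos : 0 < Real.sin (β / 2) :=
    Real.sin_pos_of_pos_of_lt_pi (by positivity) (by linarith)
  have hmul := sin_half_mul_sum_cos β n
  rw [hsin, mul_zero, ← hsum] at hmul
  exact (mul_eq_zero.mp hmul).resolve_left hpos.ne'

lemma alternatingSum_eval_node_eq_zero {n : ℕ} {q : ℝ[X]} (hq : q.degree < n) :
    alternatingSum n (fun k => q.eval (node n k)) = 0 := by
  let S : Polynomial.Sequence ℝ := ⟨fun m => T ℝ m, fun m => by simp⟩
  let L : ℝ[X] →ₗ[ℝ] ℝ := alternatingSum n ∘ₗ LinearMap.pi fun k => leval (node n k)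
  have hker : degreeLT ℝ n ≤ L.ker := by
    rw [← S.span_degreeLT fun m _ => isUnit_iff_ne_zero.2 (leadingCoeff_ne_zero.2 (S.ne_zero m)),
      Submodule.span_le]
    rintro _ ⟨m, hm, rfl⟩
    exact alternatingSum_eval_T_node_eq_zero hm
  exact hker (mem_degreeLT.2 hq)

lemma neg_one_pow_mul_eval_cos_derivative_T_nonneg {n k : ℕ} {θ : ℝ} (hθ : θ ∈ Ioo 0 Real.pi)
    (hlow : k * Real.pi ≤ n * θ) (hupp : n * θ ≤ (k + 1) * Real.pi) :
    0 ≤ (-1) ^ k * (derivative (T ℝ n)).eval (Real.cos θ) := by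
  have hsin : 0 < Real.sin θ := Real.sin_pos_of_mem_Ioo hθ
  have hU : (U ℝ (n - 1 : ℤ)).eval (Real.cos θ) * Real.sin θ = Real.sin (n * θ) := by
    simp
  refine nonneg_of_mul_nonneg_left ?_ hsin
  calc 0 ≤ n * Real.sin (n * θ - k * Real.pi) :=
        mul_nonneg n.cast_nonneg
          (Real.sin_nonneg_of_nonneg_of_le_pi (by linarith) (by linarith))
    _ = (-1) ^ k * (derivative (T ℝ n)).eval (Real.cos θ) * Real.sin θ := by
        rw [Real.sin_sub_nat_mul_pi, ← hU, T_derivative_eq_U]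
        simp only [Int.cast_natCast, eval_mul, eval_natCast]
        ring

lemma neg_one_pow_mul_eval_derivative_T_nonneg {n k : ℕ} (hk : k < n) {x : ℝ}
    (hx : x ∈ Icc (node n (k + 1)) (node n k)) :
    0 ≤ (-1) ^ k * (derivative (T ℝ n)).eval x := by
  have hn : (0 : ℝ) < n := by exact_mod_cast k.zero_le.trans_lt hk
  have hk' : ((k + 1 : ℕ) : ℝ) ≤ n := by exact_mod_cast hk
  have hclosed : IsClosed {x : ℝ | 0 ≤ (-1) ^ k * (derivative (T ℝ n)).eval x} :=
    isClosed_le continuous_const (by fun_prop)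
  have harccos {j : ℕ} (hj : (j : ℝ) ≤ n) : Real.arccos (node n j) = j * Real.pi / n :=
    Real.arccos_cos (by positivity) (div_le_of_le_mul₀ hn.le Real.pi_pos.le (by
      rw [mul_comm Real.pi]; gcongr))
  rw [← closure_Ioo (node_lt hk k.lt_succ_self).ne] at hx
  refine closure_minimal (fun x hx => ?_) hclosed hx
  have hx₁ : -1 < x := node_mem_Icc.1.trans_lt hx.1
  have hx₂ : x < 1 := hx.2.trans_le node_mem_Icc.2
  have hlow := Real.arccos_le_arccos hx.2.le
  have hupp := Real.arccos_le_arccos hx.1.le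
  rw [harccos ((Nat.cast_le.2 k.le_succ).trans hk'), div_le_iff₀' hn] at hlow
  rw [harccos hk', le_div_iff₀' hn, Nat.cast_succ] at hupp
  rw [mem_ofPred_eq, ← Real.cos_arccos hx₁.le hx₂.le]
  exact neg_one_pow_mul_eval_cos_derivative_T_nonneg
    ⟨Real.arccos_pos.2 hx₂, Real.arccos_lt_pi.2 hx₁⟩ hlow hupp

end ChebyshevNodes

section MinPolyOn

open Polynomial.Chebyshev hiding C

variable {n : ℕ} {a b : ℝ}

/-- The affine polynomial that carries `[a, b]` onto `[-1, 1]`, with the sign of the constant term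
moved inside `C` so that lemmas on `C c * X + C d` apply. -/
def rescale (a b : ℝ) : ℝ[X] := C (2 / (b - a)) * X + C (-((a + b) / (b - a)))

lemma eval_rescale_left (hab : a ≠ b) : (rescale a b).eval a = -1 := by
  have hba : b - a ≠ 0 := sub_ne_zero.2 hab.symm
  simp only [rescale, eval_add, eval_mul, eval_C, eval_X]
  field_simp
  ring

lemma eval_rescale_right (hab : a ≠ b) : (rescale a b).eval b = 1 := by
  have hba : b - a ≠ 0 := sub_ne_zero.2 hab.symm
  simp only [rescale, eval_add, eval_mul, eval_C, eval_X]
  field_simp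
  ring

lemma monotone_eval_rescale (hab : a ≤ b) : Monotone fun x => (rescale a b).eval x := by
  intro x y hxy
  have : 0 ≤ 2 / (b - a) := by have := sub_nonneg.2 hab; positivity
  simp only [rescale, eval_add, eval_mul, eval_C, eval_X]
  gcongr

/-- The constant factor `((b - a) / 2)^n 2^{1-n}` of `minPolyOn n a b`, with the powers of two
collected. -/
def minPolyScale (n : ℕ) (a b : ℝ) : ℝ := 2 * ((b - a) / 4) ^ n

lemma minPolyScale_pos (hab : a < b) : 0 < minPolyScale n a b := by
  have := sub_pos.2 hab
  unfold minPolyScale; positivity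

lemma minPolyOn_eq (n : ℕ) (a b : ℝ) :
    minPolyOn n a b = C (minPolyScale n a b) * (T ℝ n - 1).comp (rescale a b) := by
  have hscale : ((b - a) / 2) ^ n * (2 : ℝ) ^ (1 - (n : ℤ)) = minPolyScale n a b := by
    rw [minPolyScale, zpow_sub₀ two_ne_zero, zpow_one, zpow_natCast, ← mul_div_assoc, mul_comm,
      mul_div_assoc, ← div_pow]
    norm_num [div_div]
  rw [minPolyOn, minPoly, mul_comp, Polynomial.C_comp, ← mul_assoc, ← Polynomial.C_mul, hscale,
    rescale, map_neg, ← sub_eq_add_neg]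

lemma eval_minPolyOn (n : ℕ) (a b x : ℝ) :
    (minPolyOn n a b).eval x =
      minPolyScale n a b * ((T ℝ n).eval ((rescale a b).eval x) - 1) := by
  simp [minPolyOn_eq]

lemma eval_minPolyOn_right (hab : a ≠ b) : (minPolyOn n a b).eval b = 0 := by
  simp [eval_minPolyOn, eval_rescale_right hab]

lemma eval_minPolyOn_left (hab : a ≠ b) :
    (minPolyOn n a b).eval a = minPolyScale n a b * ((-1) ^ n - 1) := by
  simp [eval_minPolyOn, eval_rescale_left hab]

lemma natDegree_T_sub_one : (T ℝ n - 1).natDegree = n := by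
  simpa using natDegree_sub_C (p := T ℝ n) (a := 1)

lemma leadingCoeff_T_sub_one (hn : n ≠ 0) : (T ℝ n - 1).leadingCoeff = 2 ^ (n - 1) := by
  have hdeg : (1 : ℝ[X]).degree < (T ℝ n).degree := by
    simpa [degree_one] using Nat.pos_of_ne_zero hn
  simp [leadingCoeff_sub_of_degree_lt hdeg]

lemma isMonicOfDegree_minPolyOn (hn : n ≠ 0) (hab : a ≠ b) :
    IsMonicOfDegree (minPolyOn n a b) n := by
  have hba : b - a ≠ 0 := sub_ne_zero.2 hab.symm
  have hslope : 2 / (b - a) ≠ 0 := div_ne_zero two_ne_zero hba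
  have hscale : minPolyScale n a b ≠ 0 := by simp [minPolyScale, hba]
  have hdeg : (rescale a b).natDegree = 1 := natDegree_linear hslope
  constructor
  · rw [minPolyOn_eq, natDegree_C_mul hscale, natDegree_comp, hdeg, mul_one, natDegree_T_sub_one]
  · rw [Monic, minPolyOn_eq, leadingCoeff_mul, leadingCoeff_C,
      leadingCoeff_comp (hdeg ▸ one_ne_zero), leadingCoeff_T_sub_one hn, natDegree_T_sub_one,
      rescale, leadingCoeff_linear hslope, minPolyScale]
    calc 2 * ((b - a) / 4) ^ n * (2 ^ (n - 1) * (2 / (b - a)) ^ n)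
        = 2 ^ (n - 1) * 2 * ((b - a) / 4 * (2 / (b - a))) ^ n := by rw [mul_pow]; ring
      _ = 2 ^ n * (1 / 2) ^ n := by
          rw [pow_sub_one_mul hn]
          congr 2
          field_simp
          norm_num
      _ = 1 := by rw [← mul_pow]; norm_num

/-- The extrema of `minPolyOn n a b` on `[a, b]`, from right to left. -/
def nodeOn (n : ℕ) (a b : ℝ) (k : ℕ) : ℝ :=
  (b - a) / 2 * node n k + (a + b) / 2

lemma nodeOn_zero (n : ℕ) (a b : ℝ) : nodeOn n a b 0 = b := by
  rw [nodeOn, node_eq_one]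
  ring

lemma nodeOn_self (hn : n ≠ 0) (a b : ℝ) : nodeOn n a b n = a := by
  rw [nodeOn, node_eq_neg_one hn]
  ring

lemma strictAntiOn_nodeOn (n : ℕ) (hab : a < b) : StrictAntiOn (nodeOn n a b) (Iic n) := by
  intro i _ j hj hij
  have := sub_pos.2 hab
  unfold nodeOn
  gcongr
  exact node_lt hj hij

lemma nodeOn_mem_Icc (hab : a ≤ b) (k : ℕ) : nodeOn n a b k ∈ Icc a b := by
  obtain ⟨hlow, hupp⟩ := node_mem_Icc (n := n) (i := k)
  have := sub_nonneg.2 hab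
  constructor <;> unfold nodeOn <;> nlinarith

lemma eval_rescale_nodeOn (hab : a ≠ b) (k : ℕ) :
    (rescale a b).eval (nodeOn n a b k) = node n k := by
  have hba : b - a ≠ 0 := sub_ne_zero.2 hab.symm
  simp only [rescale, nodeOn, eval_add, eval_mul, eval_C, eval_X]
  field_simp
  ring

lemma alternatingSum_eval_nodeOn_eq_zero {q : ℝ[X]} (hq : q.natDegree < n) (a b : ℝ) :
    alternatingSum n (fun k => q.eval (nodeOn n a b k)) = 0 := by
  set L : ℝ[X] := C ((b - a) / 2) * X + C ((a + b) / 2) with hL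
  have hdeg : (q.comp L).degree < n := by
    refine degree_le_natDegree.trans_lt (Nat.cast_lt.2 (natDegree_comp_le.trans_lt ?_))
    exact (mul_le_of_le_one_right' natDegree_linear_le).trans_lt hq
  simpa [hL, nodeOn] using alternatingSum_eval_node_eq_zero hdeg

lemma alternatingSum_eval_nodeOn_congr (hn : n ≠ 0) {p q : ℝ[X]} (hp : IsMonicOfDegree p n)
    (hq : IsMonicOfDegree q n) (a b : ℝ) :
    alternatingSum n (fun k => p.eval (nodeOn n a b k)) =
      alternatingSum n (fun k => q.eval (nodeOn n a b k)) := by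
  refine sub_eq_zero.1 ((map_sub _ _ _).symm.trans ?_)
  exact (alternatingSum_congr fun k _ => (eval_sub ..).symm).trans
    (alternatingSum_eval_nodeOn_eq_zero (hp.natDegree_sub_lt hn hq) a b)

lemma alternatingSum_eval_minPolyOn_nodeOn (n : ℕ) (hab : a ≠ b) :
    alternatingSum n (fun k => (minPolyOn n a b).eval (nodeOn n a b k)) =
      2 * n * minPolyScale n a b := by
  have hval : ∀ k ≤ n, (minPolyOn n a b).eval (nodeOn n a b k) =
      minPolyScale n a b * ((-1) ^ k - 1) := fun k hk => by
    rw [eval_minPolyOn, eval_rescale_nodeOn hab, eval_T_real_node (Finset.mem_Iic.2 hk)]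
  have hterm (k : ℕ) : (-1) ^ k * (minPolyScale n a b * ((-1) ^ k - 1) -
      minPolyScale n a b * ((-1) ^ (k + 1) - 1)) = 2 * minPolyScale n a b := by
    linear_combination (2 * minPolyScale n a b) *
      (Even.neg_one_pow (Even.add_self k) : (-1 : ℝ) ^ (k + k) = 1)
  simp only [alternatingSum_congr hval, alternatingSum_apply, hterm, Finset.sum_const,
    Finset.card_range, nsmul_eq_mul]
  ring

end MinPolyOn

section Extremality

variable {n : ℕ} {a b : ℝ}

lemma neg_one_pow_mul_eval_derivative_minPolyOn_nonneg (hab : a < b) {k : ℕ} (hk : k < n) {x : ℝ}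
    (hx : x ∈ Icc (nodeOn n a b (k + 1)) (nodeOn n a b k)) :
    0 ≤ (-1) ^ k * (derivative (minPolyOn n a b)).eval x := by
  have := sub_pos.2 hab
  have hscale := minPolyScale_pos (n := n) hab
  have hT := neg_one_pow_mul_eval_derivative_T_nonneg hk (x := (rescale a b).eval x) (by
    rw [← eval_rescale_nodeOn hab.ne, ← eval_rescale_nodeOn (n := n) hab.ne k]
    exact ⟨monotone_eval_rescale hab.le hx.1, monotone_eval_rescale hab.le hx.2⟩)
  have heval : (derivative (minPolyOn n a b)).eval x = minPolyScale n a b * (2 / (b - a)) *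
      (derivative (Chebyshev.T ℝ n)).eval ((rescale a b).eval x) := by
    have hslope : derivative (rescale a b) = C (2 / (b - a)) := by simp [rescale]
    simp [minPolyOn_eq, derivative_comp, hslope, mul_assoc]
  rw [heval, mul_left_comm]
  positivity

lemma hasDerivWithinAt_eval (p : ℝ[X]) :
    ∀ x ∈ Icc a b, HasDerivWithinAt (fun x => p.eval x) ((derivative p).eval x) (Icc a b) x :=
  fun x _ => (p.hasDerivAt x).hasDerivWithinAt

lemma alternatingSum_eval_nodeOn_eq_integral_abs_iff (hn : n ≠ 0) (hab : a < b) (p : ℝ[X]) :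
    alternatingSum n (fun k => p.eval (nodeOn n a b k)) = ∫ x in a..b, |(derivative p).eval x| ↔
      ∀ k < n, ∀ x ∈ Icc (nodeOn n a b (k + 1)) (nodeOn n a b k),
        0 ≤ (-1) ^ k * (derivative p).eval x := by
  simpa only [nodeOn_zero, nodeOn_self hn] using!
    alternatingSum_comp_eq_integral_abs_iff (hasDerivWithinAt_eval p)
      (derivative p).continuous.continuousOn (fun k _ => nodeOn_mem_Icc hab.le k)
      (strictAntiOn_nodeOn n hab)

lemma alternatingSum_eval_nodeOn_le_integral_abs (hn : n ≠ 0) (hab : a < b) (p : ℝ[X]) :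
    alternatingSum n (fun k => p.eval (nodeOn n a b k)) ≤
      ∫ x in a..b, |(derivative p).eval x| := by
  simpa only [nodeOn_zero, nodeOn_self hn] using!
    alternatingSum_comp_le_integral_abs (hasDerivWithinAt_eval p)
      (derivative p).continuous.continuousOn (fun k _ => nodeOn_mem_Icc hab.le k)
      (strictAntiOn_nodeOn n hab).antitoneOn

lemma alternatingSum_eval_minPolyOn_eq_integral_abs (hn : n ≠ 0) (hab : a < b) :
    alternatingSum n (fun k => (minPolyOn n a b).eval (nodeOn n a b k)) =
      ∫ x in a..b, |(derivative (minPolyOn n a b)).eval x| :=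
  (alternatingSum_eval_nodeOn_eq_integral_abs_iff hn hab _).2 fun _ hk _ hx =>
    neg_one_pow_mul_eval_derivative_minPolyOn_nonneg hab hk hx

lemma integral_abs_derivative_minPolyOn (hn : n ≠ 0) (hab : a < b) :
    ∫ x in a..b, |(derivative (minPolyOn n a b)).eval x| = 2 * n * minPolyScale n a b := by
  rw [← alternatingSum_eval_minPolyOn_eq_integral_abs hn hab,
    alternatingSum_eval_minPolyOn_nodeOn n hab.ne]

lemma integral_abs_derivative_minPolyOn_le (hn : n ≠ 0) (hab : a < b) {p : ℝ[X]}
    (hp : IsMonicOfDegree p n) :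
    ∫ x in a..b, |(derivative (minPolyOn n a b)).eval x| ≤
      ∫ x in a..b, |(derivative p).eval x| := by
  rw [← alternatingSum_eval_minPolyOn_eq_integral_abs hn hab,
    alternatingSum_eval_nodeOn_congr hn (isMonicOfDegree_minPolyOn hn hab.ne) hp]
  exact alternatingSum_eval_nodeOn_le_integral_abs hn hab p

lemma eq_zero_of_forall_neg_one_pow_mul_nonneg {f : ℝ → ℝ} {y : ℕ → ℝ}
    (hy : AntitoneOn y (Iic n))
    (hf : ∀ k < n, ∀ x ∈ Icc (y (k + 1)) (y k), 0 ≤ (-1) ^ k * f x) {k : ℕ} (hk : k + 1 < n) :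
    f (y (k + 1)) = 0 := by
  have hleft := hf (k + 1) hk _ ⟨hy hk.le hk (k + 1).le_succ, le_rfl⟩
  have hright := hf k (k.lt_succ_self.trans hk) _
    ⟨le_rfl, hy (k.lt_succ_self.trans hk).le hk.le k.le_succ⟩
  rw [pow_succ, mul_neg_one, neg_mul] at hleft
  exact (mul_eq_zero.1 (le_antisymm (neg_nonneg.1 hleft) hright)).resolve_left (by simp)

lemma derivative_eq_derivative_minPolyOn (hn : n ≠ 0) (hab : a < b) {p : ℝ[X]}
    (hp : IsMonicOfDegree p n)
    (heq : ∫ x in a..b, |(derivative p).eval x| =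
      ∫ x in a..b, |(derivative (minPolyOn n a b)).eval x|) :
    derivative p = derivative (minPolyOn n a b) := by
  have hφ := isMonicOfDegree_minPolyOn hn hab.ne
  have hanti := strictAntiOn_nodeOn n hab
  have hsign := (alternatingSum_eval_nodeOn_eq_integral_abs_iff hn hab p).1 <| by
    rw [alternatingSum_eval_nodeOn_congr hn hp hφ,
      alternatingSum_eval_minPolyOn_eq_integral_abs hn hab, heq]
  have hroot (i : Fin (n - 1)) :
      (derivative (p - minPolyOn n a b)).eval (nodeOn n a b (i + 1)) = 0 := by
    have hi : (i : ℕ) + 1 < n := by omega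
    rw [derivative_sub, eval_sub,
      eq_zero_of_forall_neg_one_pow_mul_nonneg hanti.antitoneOn hsign hi,
      eq_zero_of_forall_neg_one_pow_mul_nonneg hanti.antitoneOn
        (fun _ hk _ => neg_one_pow_mul_eval_derivative_minPolyOn_nonneg hab hk) hi, sub_zero]
  have hinj : Function.Injective fun i : Fin (n - 1) => nodeOn n a b (i + 1) := fun i j hij => by
    have := hanti.injOn (mem_Iic.2 (by omega)) (mem_Iic.2 (by omega)) hij
    omega
  have hzero : derivative (p - minPolyOn n a b) = 0 := by
    by_cases hdeg : (p - minPolyOn n a b).natDegree = 0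
    · exact derivative_of_natDegree_zero hdeg
    · refine eq_zero_of_natDegree_lt_card_of_eval_eq_zero _ hinj hroot ?_
      have hlt := natDegree_derivative_lt hdeg
      have hlt' := hp.natDegree_sub_lt hn hφ
      rw [Fintype.card_fin]
      omega
  rwa [derivative_sub, sub_eq_zero] at hzero

lemma eq_minPolyOn_of_add_integral_abs_le (hn : n ≠ 0) (hab : a < b) {p : ℝ[X]}
    (hp : IsMonicOfDegree p n)
    (hle : |p.eval b| + ∫ x in a..b, |(derivative p).eval x| ≤
      ∫ x in a..b, |(derivative (minPolyOn n a b)).eval x|) :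
    p = minPolyOn n a b := by
  have hmin := integral_abs_derivative_minPolyOn_le hn hab hp
  have hb : p.eval b = 0 := abs_eq_zero.1 (by linarith [abs_nonneg (p.eval b)])
  have hderiv := derivative_eq_derivative_minPolyOn hn hab hp
    (by linarith [abs_nonneg (p.eval b)])
  have hconst := eq_C_of_derivative_eq_zero (p := p - minPolyOn n a b) (by
    rw [derivative_sub, hderiv, sub_self])
  have hzero := congrArg (eval b) hconst
  rw [eval_sub, hb, eval_minPolyOn_right hab.ne, sub_self, eval_C] at hzero
  rwa [← hzero, C_0, sub_eq_zero] at hconst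

end Extremality

section Distribution

open scoped ContDiff

variable {a b : ℝ}

lemma coe_lineDerivOp_one (η : 𝓓(openInterval a b, ℝ)) :
    ⇑(∂_{(1 : ℝ)} η : 𝓓(openInterval a b, ℝ)) = deriv η := by
  ext x
  rw [TestFunction.lineDerivOp_eq_lineDerivCLM ℝ, TestFunction.lineDerivCLM_apply_of_le (by simp),
    (η.contDiff.differentiable (by simp)).differentiableAt.lineDeriv_eq_fderiv,
    fderiv_apply_one_eq_deriv]

lemma distDeriv_apply (T : 𝓓'(openInterval a b, ℝ)) (η : 𝓓(openInterval a b, ℝ)) :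
    distDeriv T η = -T (∂_{(1 : ℝ)} η) :=
  rfl

lemma distDeriv_sub (S T : 𝓓'(openInterval a b, ℝ)) :
    distDeriv (S - T) = distDeriv S - distDeriv T := by
  simp only [distDeriv, Distribution.lineDerivOp_eq_lineDerivCLM, map_sub]

lemma integrable_testFunction (η : 𝓓(openInterval a b, ℝ)) : Integrable η :=
  η.continuous.integrable_of_hasCompactSupport η.hasCompactSupport

lemma integral_testFunction_mul (η : 𝓓(openInterval a b, ℝ)) (F : ℝ → ℝ) :
    ∫ x, η x * F x = ∫ x in a..b, η x * F x := by
  refine (intervalIntegral.integral_eq_integral_of_support_subset fun x hx => ?_).symm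
  exact Ioo_subset_Ioc_self <|
    η.tsupport_subset <| subset_tsupport _ <| Function.support_mul_subset_left _ _ hx

lemma testFunction_eq_zero {x : ℝ} (η : 𝓓(openInterval a b, ℝ)) (hx : x ∉ Ioo a b) : η x = 0 :=
  image_eq_zero_of_notMem_tsupport fun h => hx (η.tsupport_subset h)

lemma locallyIntegrableOn_openInterval {F : ℝ → ℝ} (hF : ContinuousOn F (Icc a b)) :
    LocallyIntegrableOn F (openInterval a b : Set ℝ) :=
  (hF.mono Ioo_subset_Icc_self).locallyIntegrableOn measurableSet_Ioo

lemma ofFun_apply {F : ℝ → ℝ} (hF : ContinuousOn F (Icc a b)) (η : 𝓓(openInterval a b, ℝ)) :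
    ofFun a b F η = ∫ x, η x * F x :=
  TestFunction.integralAgainstBilinCLM_eq_integral (B := ContinuousLinearMap.mul ℝ ℝ)
    (locallyIntegrableOn_openInterval hF)

lemma ofFun_sub {F G : ℝ → ℝ} (hF : ContinuousOn F (Icc a b)) (hG : ContinuousOn G (Icc a b)) :
    ofFun a b (F - G) = ofFun a b F - ofFun a b G := by
  ext η
  have integrable_mul {H : ℝ → ℝ} (hH : ContinuousOn H (Icc a b)) :
      Integrable fun x => η x * H x :=
    TestFunction.integrable_bilin (ContinuousLinearMap.mul ℝ ℝ)
      (locallyIntegrableOn_openInterval hH) η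
  rw [sub_apply, ofFun_apply hF, ofFun_apply hG, ofFun_apply (hF.sub hG),
    ← integral_sub (integrable_mul hF) (integrable_mul hG)]
  simp only [Pi.sub_apply, mul_sub]

lemma distDeriv_ofFun {F F' : ℝ → ℝ} (hab : a ≤ b) (hF : ContinuousOn F (Icc a b))
    (hF' : ContinuousOn F' (Icc a b)) (hd : ∀ x ∈ Ioo a b, HasDerivAt F (F' x) x) :
    distDeriv (ofFun a b F) = ofFun a b F' := by
  ext η
  have hη (x : ℝ) : HasDerivAt η (deriv η x) x :=
    (η.contDiff.differentiable (by simp)).differentiableAt.hasDerivAt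
  have hη' : Continuous (deriv η) := η.contDiff.continuous_deriv (by simp)
  have by_parts := intervalIntegral.integral_mul_deriv_eq_deriv_mul_of_hasDerivAt
    (a := a) (b := b) (v := F) η.continuous.continuousOn (by rwa [uIcc_of_le hab]) (fun x _ => hη x)
    (by rwa [min_eq_left hab, max_eq_right hab]) (hη'.intervalIntegrable _ _)
    (ContinuousOn.intervalIntegrable (by rwa [uIcc_of_le hab]))
  rw [testFunction_eq_zero η (by simp : a ∉ Ioo a b),
    testFunction_eq_zero η (by simp : b ∉ Ioo a b), zero_mul, zero_mul, sub_zero, zero_sub]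
    at by_parts
  rw [distDeriv_apply, ofFun_apply hF, ofFun_apply hF', integral_testFunction_mul,
    integral_testFunction_mul, coe_lineDerivOp_one, by_parts]

lemma exists_subset_Icc_of_isCompact (hab : a < b) {K : Set ℝ} (hK : IsCompact K)
    (hKab : K ⊆ Ioo a b) : ∃ c ∈ Ioo a b, ∃ d ∈ Ioo a b, K ⊆ Icc c d := by
  obtain ⟨m, hm⟩ := nonempty_Ioo.mpr hab
  have hK' : IsCompact (insert m K) := hK.insert m
  have hKab' : insert m K ⊆ Ioo a b := insert_subset hm hKab
  exact ⟨_, hKab' (hK'.sInf_mem (insert_nonempty m K)),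
    _, hKab' (hK'.sSup_mem (insert_nonempty m K)),
    (subset_insert m K).trans (subset_Icc_csInf_csSup hK'.bddBelow hK'.bddAbove)⟩

lemma support_integral_Iic_subset_Icc {u : ℝ → ℝ} {c d : ℝ} (hu : Function.support u ⊆ Icc c d)
    (hu0 : ∫ x, u x = 0) : Function.support (fun x => ∫ t in Iic x, u t) ⊆ Icc c d := by
  intro x hx
  by_contra hxcd
  refine hx ?_
  rw [mem_Icc, not_and_or, not_le, not_le] at hxcd
  rcases hxcd with h | h
  · exact setIntegral_eq_zero_of_forall_eq_zero fun t ht =>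
      Function.notMem_support.mp fun htu => (hu htu).1.not_gt (ht.trans_lt h)
  · refine (setIntegral_eq_integral_of_forall_compl_eq_zero fun t ht => ?_).trans hu0
    exact Function.notMem_support.mp fun htu => ht ((hu htu).2.trans h.le)

lemma exists_lineDerivOp_eq_of_integral_eq_zero (hab : a < b) {u : 𝓓(openInterval a b, ℝ)}
    (hu : ∫ x, u x = 0) : ∃ η : 𝓓(openInterval a b, ℝ), ∂_{(1 : ℝ)} η = u := by
  let U : ℝ → ℝ := fun x => ∫ t in Iic x, u t
  have hderiv (x : ℝ) : HasDerivAt U (u x) x := by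
    have U_eq : U = fun y => U x + ∫ t in x..y, u t := by
      ext y
      rw [← intervalIntegral.integral_Iic_sub_Iic (integrable_testFunction u).integrableOn
        (integrable_testFunction u).integrableOn, add_sub_cancel]
    rw [U_eq]
    exact (u.continuous.integral_hasStrictDerivAt x x).hasDerivAt.const_add _
  have deriv_U : deriv U = u := funext fun x => (hderiv x).deriv
  have smooth : ContDiff ℝ ∞ U := by
    rw [contDiff_infty_iff_deriv, deriv_U]
    exact ⟨fun x => (hderiv x).differentiableAt, u.contDiff⟩
  obtain ⟨c, hc, d, hd, hcd⟩ :=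
    exists_subset_Icc_of_isCompact hab u.hasCompactSupport u.tsupport_subset
  have hsupp := support_integral_Iic_subset_Icc ((subset_tsupport u).trans hcd) hu
  refine ⟨⟨U, smooth, .of_support_subset_isCompact isCompact_Icc hsupp, ?_⟩, ?_⟩
  · exact (closure_minimal hsupp isClosed_Icc).trans (Icc_subset_Ioo hc.1 hd.2)
  · exact DFunLike.coe_injective ((coe_lineDerivOp_one _).trans deriv_U)

lemma exists_testFunction_integral_eq_one (hab : a < b) :
    ∃ u : 𝓓(openInterval a b, ℝ), ∫ x, u x = 1 := by
  let bump : ContDiffBump ((a + b) / 2) :=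
    ⟨(b - a) / 8, (b - a) / 4, by linarith, by linarith⟩
  refine ⟨⟨bump.normed volume, bump.contDiff_normed, bump.hasCompactSupport_normed, ?_⟩,
    bump.integral_normed⟩
  rw [bump.tsupport_normed_eq, Real.closedBall_eq_Icc]
  exact Icc_subset_Ioo (by simp only [bump]; linarith) (by simp only [bump]; linarith)

lemma exists_eq_ofFun_const_of_distDeriv_eq_zero (hab : a < b) {T : 𝓓'(openInterval a b, ℝ)}
    (hT : distDeriv T = 0) : ∃ c : ℝ, T = ofFun a b fun _ => c := by
  obtain ⟨u, hu⟩ := exists_testFunction_integral_eq_one hab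
  refine ⟨T u, ?_⟩
  ext η
  obtain ⟨ζ, hζ⟩ : ∃ ζ : 𝓓(openInterval a b, ℝ), ∂_{(1 : ℝ)} ζ = η - (∫ x, η x) • u := by
    apply exists_lineDerivOp_eq_of_integral_eq_zero hab
    simp only [sub_apply, smul_apply, smul_eq_mul]
    rw [integral_sub (integrable_testFunction η) ((integrable_testFunction u).const_mul _),
      integral_const_mul, hu, mul_one, sub_self]
  have vanish : T (η - (∫ x, η x) • u) = 0 := by
    rw [← hζ, ← neg_eq_zero, ← distDeriv_apply, hT]
    rfl
  rw [map_sub, map_smul, smul_eq_mul, sub_eq_zero] at vanish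
  rw [ofFun_apply continuousOn_const, integral_mul_const, vanish]

lemma eqOn_of_ofFun_eq (hab : a < b) {F G : ℝ → ℝ} (hF : ContinuousOn F (Icc a b))
    (hG : ContinuousOn G (Icc a b)) (h : ofFun a b F = ofFun a b G) : EqOn F G (Icc a b) := by
  have ae_zero : ∀ᵐ x, x ∈ Ioo a b → F x - G x = 0 := by
    refine isOpen_Ioo.ae_eq_zero_of_integral_contDiff_smul_eq_zero
      (locallyIntegrableOn_openInterval (hF.sub hG)) fun η hη hηc hηs => ?_
    have := ofFun_apply (hF.sub hG) (⟨η, hη, hηc, hηs⟩ : 𝓓(openInterval a b, ℝ))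
    rw [ofFun_sub hF hG, h, sub_self] at this
    exact this.symm
  refine Measure.eqOn_Icc_of_ae_eq volume hab.ne ?_ hF hG
  rw [Filter.EventuallyEq, ← Measure.restrict_congr_set Ioo_ae_eq_Icc,
    ae_restrict_iff' measurableSet_Ioo]
  filter_upwards [ae_zero] with x hx hxI using sub_eq_zero.mp (hx hxI)

lemma IsPrimitive.eqOn (hab : a < b) {T : 𝓓'(openInterval a b, ℝ)} {F G : ℝ → ℝ}
    (hF : IsPrimitive F T) (hG : IsPrimitive G T) : EqOn F G (Icc a b) := by
  obtain ⟨hFc, hFa, hFT⟩ := hF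
  obtain ⟨hGc, hGa, hGT⟩ := hG
  obtain ⟨c, hc⟩ := exists_eq_ofFun_const_of_distDeriv_eq_zero hab
    (T := ofFun a b F - ofFun a b G) (by rw [distDeriv_sub, hFT, hGT, sub_self])
  rw [← ofFun_sub hFc hGc] at hc
  have sub_eq_const := eqOn_of_ofFun_eq hab (hFc.sub hGc) continuousOn_const hc
  have c_eq_zero : F a - G a = c := sub_eq_const (left_mem_Icc.mpr hab.le)
  rw [hFa, hGa, sub_zero] at c_eq_zero
  exact fun x hx => sub_eq_zero.mp ((sub_eq_const hx).trans c_eq_zero.symm)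

lemma IsPrimitive.alexNorm_eq (hab : a < b) {T : 𝓓'(openInterval a b, ℝ)} {F : ℝ → ℝ}
    (hF : IsPrimitive F T) : alexNorm T = sSup ((fun x => |F x|) '' Icc a b) := by
  have hT : ∃ F : ℝ → ℝ, IsPrimitive F T := ⟨F, hF⟩
  have cpIntegral_eqOn : EqOn (cpIntegral T) F (Icc a b) := by
    rw [cpIntegral, dif_pos hT]
    exact hT.choose_spec.eqOn hab hF
  rw [alexNorm, image_congr fun x hx => by rw [cpIntegral_eqOn hx]]

lemma iterate_distDeriv_ofFun (hab : a < b) {f : ℝ → ℝ} {k : ℕ} (hf : ContDiffOn ℝ k f (Icc a b)) :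
    distDeriv^[k] (ofFun a b f) = ofFun a b (iteratedDerivWithin k f (Icc a b)) := by
  have unique := uniqueDiffOn_Icc hab
  induction k with
  | zero => rw [iteratedDerivWithin_zero, Function.iterate_zero_apply]
  | succ k ih =>
    rw [Function.iterate_succ_apply', ih (hf.of_le (by exact_mod_cast k.le_succ))]
    refine distDeriv_ofFun hab.le
      (hf.continuousOn_iteratedDerivWithin (by exact_mod_cast k.le_succ) unique)
      (hf.continuousOn_iteratedDerivWithin le_rfl unique) fun x hx => ?_
    rw [iteratedDerivWithin_succ]
    exact (hf.differentiableOn_iteratedDerivWithin (by exact_mod_cast k.lt_succ_self) unique x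
      (Ioo_subset_Icc_self hx)).hasDerivWithinAt.hasDerivAt (Icc_mem_nhds hx.1 hx.2)

lemma isPrimitive_distDerivFun (hab : a < b) {f : ℝ → ℝ} {n : ℕ}
    (hf : ContDiffOn ℝ n f (Icc a b)) :
    IsPrimitive (fun x => iteratedDerivWithin n f (Icc a b) x -
      iteratedDerivWithin n f (Icc a b) a) (distDerivFun (n + 1) a b f) := by
  have hcont := hf.continuousOn_iteratedDerivWithin le_rfl (uniqueDiffOn_Icc hab)
  have distDeriv_const (c : ℝ) : distDeriv (ofFun a b fun _ => c) = 0 := by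
    rw [distDeriv_ofFun hab.le continuousOn_const continuousOn_const
      fun x _ => hasDerivAt_const x c]
    ext η
    simp [ofFun_apply continuousOn_const]
  refine ⟨hcont.sub continuousOn_const, sub_self _,
    (congrArg distDeriv (ofFun_sub hcont continuousOn_const)).trans ?_⟩
  rw [distDeriv_sub, distDeriv_const, sub_zero, distDerivFun, Function.iterate_succ_apply',
    iterate_distDeriv_ofFun hab hf]

end Distribution

section RiemannStieltjes

variable {a b c d : ℝ} {F G g g' : ℝ → ℝ} {I J : ℝ}

lemma abs_mul_sub_sub_integral_mul_le {y ε : ℝ} (hcd : c ≤ d) (hF : ContinuousOn F (Icc c d))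
    (hFy : ∀ x ∈ Icc c d, |y - F x| ≤ ε)
    (hg : ∀ x ∈ Icc c d, HasDerivWithinAt g (g' x) (Icc c d) x)
    (hg' : ContinuousOn g' (Icc c d)) :
    |y * (g d - g c) - ∫ x in c..d, F x * g' x| ≤ ε * ∫ x in c..d, |g' x| := by
  have hg'_int := hg'.intervalIntegrable_of_Icc (μ := volume) hcd
  have hFg' : IntervalIntegrable (fun x => F x * g' x) volume c d :=
    (hF.mul hg').intervalIntegrable_of_Icc hcd
  rw [← integral_eq_sub_of_hasDerivWithinAt_Icc hg hg' (left_mem_Icc.2 hcd) (right_mem_Icc.2 hcd),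
    ← intervalIntegral.integral_const_mul, ← intervalIntegral.integral_const_mul,
    ← intervalIntegral.integral_sub (hg'_int.const_mul y) hFg']
  refine (intervalIntegral.abs_integral_le_integral_abs hcd).trans <|
    intervalIntegral.integral_mono_on hcd ((hg'_int.const_mul y).sub hFg').abs
      (hg'_int.abs.const_mul ε) fun x hx => ?_
  rw [← sub_mul, abs_mul]
  exact mul_le_mul_of_nonneg_right (hFy x hx) (abs_nonneg _)

lemma hasRSIntegral_of_hasDerivWithinAt (hF : ContinuousOn F (Icc a b))
    (hg : ∀ x ∈ Icc a b, HasDerivWithinAt g (g' x) (Icc a b) x)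
    (hg' : ContinuousOn g' (Icc a b)) :
    HasRSIntegral a b F g (∫ x in a..b, F x * g' x) := by
  intro ε hε
  obtain ⟨η, hη, hηε⟩ := exists_pos_mul_lt hε (∫ x in a..b, |g' x|)
  obtain ⟨δ, hδ, hFδ⟩ := Metric.uniformContinuousOn_iff.mp
    (isCompact_Icc.uniformContinuousOn_of_continuous hF) η hη
  refine ⟨δ, hδ, fun N x t hx hx0 hxN hmesh ht => ?_⟩
  have hcell {i : ℕ} (hi : i < N) : Icc (x i) (x (i + 1)) ⊆ Icc a b :=
    Icc_subset_Icc (hx0 ▸ hx i.zero_le) (hxN ▸ hx hi)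
  have sum_integral {u : ℝ → ℝ} (hu : ContinuousOn u (Icc a b)) :
      ∑ i ∈ Finset.range N, ∫ s in x i..x (i + 1), u s = ∫ s in a..b, u s := by
    rw [intervalIntegral.sum_integral_adjacent_intervals fun i hi =>
      ((hu.mono (hcell hi)).intervalIntegrable_of_Icc (hx i.le_succ)), hx0, hxN]
  have hterm (i : ℕ) (hi : i < N) : |F (t i) * (g (x (i + 1)) - g (x i)) -
      ∫ s in x i..x (i + 1), F s * g' s| ≤ η * ∫ s in x i..x (i + 1), |g' s| := by
    refine abs_mul_sub_sub_integral_mul_le (hx i.le_succ) (hF.mono (hcell hi)) (fun s hs => ?_)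
      (fun s hs => (hg s (hcell hi hs)).mono (hcell hi)) (hg'.mono (hcell hi))
    exact (hFδ _ (hcell hi (ht i hi)) _ (hcell hi hs) <|
      (Real.dist_le_of_mem_Icc (ht i hi) hs).trans_lt (hmesh i hi)).le
  rw [← sum_integral (u := fun s => F s * g' s) (hF.mul hg'), ← Finset.sum_sub_distrib]
  calc _ ≤ ∑ i ∈ Finset.range N, |F (t i) * (g (x (i + 1)) - g (x i)) -
          ∫ s in x i..x (i + 1), F s * g' s| := Finset.abs_sum_le_sum_abs _ _
    _ ≤ ∑ i ∈ Finset.range N, η * ∫ s in x i..x (i + 1), |g' s| :=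
        Finset.sum_le_sum fun i hi => hterm i (Finset.mem_range.mp hi)
    _ = (∫ s in a..b, |g' s|) * η := by
        rw [← Finset.mul_sum, sum_integral hg'.abs, mul_comm]
    _ < ε := hηε

/-- The points dividing `[a, b]` into `N + 1` intervals of equal length, indexed from `0`. -/
def uniformPoint (a b : ℝ) (N i : ℕ) : ℝ := a + i * ((b - a) / (N + 1))

lemma uniformPoint_zero (a b : ℝ) (N : ℕ) : uniformPoint a b N 0 = a := by
  simp [uniformPoint]

lemma uniformPoint_last (a b : ℝ) (N : ℕ) : uniformPoint a b N (N + 1) = b := by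
  have : (N : ℝ) + 1 ≠ 0 := by positivity
  rw [uniformPoint, Nat.cast_succ, mul_div_cancel₀ _ this, add_sub_cancel]

lemma uniformPoint_succ_sub (a b : ℝ) (N i : ℕ) :
    uniformPoint a b N (i + 1) - uniformPoint a b N i = (b - a) / (N + 1) := by
  simp only [uniformPoint, Nat.cast_succ]
  ring

lemma monotone_uniformPoint (hab : a ≤ b) (N : ℕ) : Monotone (uniformPoint a b N) := by
  refine monotone_nat_of_le_succ fun i => sub_nonneg.mp ?_
  have := sub_nonneg.mpr hab
  rw [uniformPoint_succ_sub]
  positivity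

lemma uniformPoint_mem_Icc (hab : a ≤ b) {N i : ℕ} (hi : i ≤ N + 1) :
    uniformPoint a b N i ∈ Icc a b :=
  ⟨(uniformPoint_zero a b N).ge.trans (monotone_uniformPoint hab N i.zero_le),
    (monotone_uniformPoint hab N hi).trans (uniformPoint_last a b N).le⟩

lemma HasRSIntegral.tendsto_sum_uniformPoint (hab : a ≤ b) (h : HasRSIntegral a b F g I) :
    Filter.Tendsto (fun N => ∑ i ∈ Finset.range (N + 1), F (uniformPoint a b N i) *
      (g (uniformPoint a b N (i + 1)) - g (uniformPoint a b N i))) Filter.atTop (nhds I) := by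
  have mesh_tendsto : Filter.Tendsto (fun N : ℕ => (b - a) / (N + 1 : ℝ)) Filter.atTop (nhds 0) :=
    tendsto_const_nhds.div_atTop
      (Filter.tendsto_atTop_add_const_right _ _ tendsto_natCast_atTop_atTop)
  rw [Metric.tendsto_nhds]
  intro ε hε
  obtain ⟨δ, hδ, hsum⟩ := h ε hε
  filter_upwards [mesh_tendsto.eventually_lt_const hδ] with N hN
  have hmono := monotone_uniformPoint hab N
  exact hsum (N + 1) _ _ hmono (uniformPoint_zero a b N) (uniformPoint_last a b N)
    (fun i _ => (uniformPoint_succ_sub a b N i).trans_lt hN)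
    fun i _ => left_mem_Icc.mpr (hmono i.le_succ)

lemma HasRSIntegral.unique_of_eqOn (hab : a ≤ b) (hF : HasRSIntegral a b F g I)
    (hG : HasRSIntegral a b G g J) (h : EqOn F G (Icc a b)) : I = J := by
  refine tendsto_nhds_unique (hF.tendsto_sum_uniformPoint hab)
    ((hG.tendsto_sum_uniformPoint hab).congr fun N => Finset.sum_congr rfl fun i hi => ?_)
  rw [h (uniformPoint_mem_Icc hab (Finset.mem_range.mp hi).le)]

lemma HasRSIntegral.ofReal_abs_le_eVariationOn (hab : a ≤ b) (h : HasRSIntegral a b F g I)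
    (hF : ∀ x ∈ Icc a b, |F x| ≤ 1) : ENNReal.ofReal |I| ≤ eVariationOn g (Icc a b) := by
  refine le_of_tendsto ((ENNReal.continuous_ofReal.tendsto _).comp
    (h.tendsto_sum_uniformPoint hab).abs) (.of_forall fun N => ?_)
  set x := uniformPoint a b N
  have hx {i : ℕ} (hi : i ≤ N + 1) : x i ∈ Icc a b := uniformPoint_mem_Icc hab hi
  calc ENNReal.ofReal |∑ i ∈ Finset.range (N + 1), F (x i) * (g (x (i + 1)) - g (x i))|
      ≤ ENNReal.ofReal (∑ i ∈ Finset.range (N + 1), |g (x (i + 1)) - g (x i)|) := by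
        refine ENNReal.ofReal_le_ofReal <|
          (Finset.abs_sum_le_sum_abs _ _).trans (Finset.sum_le_sum fun i hi => ?_)
        rw [abs_mul]
        exact mul_le_of_le_one_left (abs_nonneg _) (hF _ (hx (Finset.mem_range.mp hi).le))
    _ = ∑ i ∈ Finset.range (N + 1), edist (g (x (i + 1))) (g (x i)) := by
        rw [ENNReal.ofReal_sum_of_nonneg fun _ _ => abs_nonneg _]
        simp only [edist_dist, Real.dist_eq]
    _ ≤ eVariationOn g (Icc a b) := eVariationOn.sum_le_of_monotoneOn_Iic
        ((monotone_uniformPoint hab N).monotoneOn _) fun i hi => hx hi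

end RiemannStieltjes

section SignApproximation

variable {a b : ℝ}

/-- A function of `u` with values in `[-1, 1]` that tends to the sign of `u` as `ε → 0`. It is
continuous for `ε > 0`. -/
def softSign (ε u : ℝ) : ℝ := u / (|u| + ε)

lemma continuous_softSign {ε : ℝ} (hε : 0 < ε) : Continuous (softSign ε) :=
  continuous_id.div (by fun_prop) fun u => (add_pos_of_nonneg_of_pos (abs_nonneg u) hε).ne'

lemma abs_softSign_le_one {ε : ℝ} (hε : 0 ≤ ε) (u : ℝ) : |softSign ε u| ≤ 1 := by
  rw [softSign, abs_div, abs_of_nonneg (by positivity : 0 ≤ |u| + ε)]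
  exact div_le_one_of_le₀ (le_add_of_nonneg_right hε) (by positivity)

lemma tendsto_softSign (u : ℝ) :
    Filter.Tendsto (softSign · u) (nhds 0) (nhds (SignType.sign u : ℝ)) := by
  rcases eq_or_ne u 0 with rfl | hu
  · simp [softSign]
  · have hlim : Filter.Tendsto (softSign · u) (nhds 0) (nhds (u / (|u| + 0))) :=
      tendsto_const_nhds.div (tendsto_const_nhds.add Filter.tendsto_id) (by simpa using hu)
    rwa [add_zero, show u / |u| = SignType.sign u by
      rw [div_eq_iff (abs_ne_zero.mpr hu), sign_mul_abs]] at hlim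

lemma exists_continuous_lt_integral_mul (hab : a ≤ b) {g : ℝ → ℝ} (hg : Continuous g) {r : ℝ}
    (hr : r < ∫ x in a..b, |g x|) :
    ∃ F : ℝ → ℝ, Continuous F ∧ F a = 0 ∧ (∀ x, |F x| ≤ 1) ∧ r < ∫ x in a..b, F x * g x := by
  let F (ε x : ℝ) : ℝ := softSign ε (x - a) * softSign ε (g x)
  have continuous_F {ε : ℝ} (hε : 0 < ε) : Continuous (F ε) :=
    ((continuous_softSign hε).comp (continuous_sub_right a)).mul ((continuous_softSign hε).comp hg)
  have abs_F_le_one {ε : ℝ} (hε : 0 < ε) (x : ℝ) : |F ε x| ≤ 1 := by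
    rw [abs_mul]
    exact mul_le_one₀ (abs_softSign_le_one hε.le _) (abs_nonneg _) (abs_softSign_le_one hε.le _)
  have hlim : Filter.Tendsto (fun ε => ∫ x in a..b, F ε x * g x) (nhdsWithin 0 (Ioi 0))
      (nhds (∫ x in a..b, |g x|)) := by
    refine intervalIntegral.tendsto_integral_filter_of_dominated_convergence (fun x => |g x|)
      ?_ ?_ (hg.abs.intervalIntegrable a b) (.of_forall fun x hx => ?_)
    · filter_upwards [self_mem_nhdsWithin] with ε hε
      exact ((continuous_F hε).mul hg).aestronglyMeasurable
    · filter_upwards [self_mem_nhdsWithin] with ε hε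
      refine .of_forall fun x _ => ?_
      rw [Real.norm_eq_abs, abs_mul]
      exact mul_le_of_le_one_left (abs_nonneg _) (abs_F_le_one hε x)
    · rw [uIoc_of_le hab] at hx
      have := ((tendsto_softSign (x - a)).mul (tendsto_softSign (g x))).mul_const (g x)
      rw [sign_pos (sub_pos.mpr hx.1), SignType.coe_one, one_mul, sign_mul_self] at this
      exact this.mono_left nhdsWithin_le_nhds
  obtain ⟨ε, hrε, hε⟩ := ((hlim.eventually_const_lt hr).and self_mem_nhdsWithin).exists
  exact ⟨F ε, continuous_F hε, by simp [F, softSign], abs_F_le_one hε, hrε⟩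

lemma eVariationOn_eq_ofReal_integral_abs (hab : a ≤ b) {g g' : ℝ → ℝ}
    (hg : ∀ x ∈ Icc a b, HasDerivWithinAt g (g' x) (Icc a b) x) (hg' : Continuous g') :
    eVariationOn g (Icc a b) = ENNReal.ofReal (∫ x in a..b, |g' x|) := by
  refine (eVariationOn_le_ofReal_integral_abs hg hg'.continuousOn).antisymm ?_
  have finite : eVariationOn g (Icc a b) ≠ ⊤ := ne_top_of_le_ne_top ENNReal.ofReal_ne_top
    (eVariationOn_le_ofReal_integral_abs hg hg'.continuousOn)
  rw [ENNReal.ofReal_le_iff_le_toReal finite]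
  refine le_of_forall_lt fun r hr => ?_
  obtain ⟨F, hF, -, hF1, hrF⟩ := exists_continuous_lt_integral_mul hab hg' hr
  exact hrF.trans_le <| (le_abs_self _).trans <| (ENNReal.ofReal_le_iff_le_toReal finite).mp <|
    (hasRSIntegral_of_hasDerivWithinAt hF.continuousOn hg
      hg'.continuousOn).ofReal_abs_le_eVariationOn hab fun x _ => hF1 x

lemma holderFactor_eq (hab : a ≤ b) (p : ℝ[X]) : holderFactor a b p =
    ENNReal.ofReal (|p.eval b| + ∫ x in a..b, |(derivative p).eval x|) := by
  rw [holderFactor, eVariationOn_eq_ofReal_integral_abs hab (hasDerivWithinAt_eval p)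
    (derivative p).continuous, ← ENNReal.ofReal_add (abs_nonneg _)
      (intervalIntegral.integral_nonneg hab fun _ _ => abs_nonneg _)]

end SignApproximation

section ContinuousPrimitiveIntegral

variable {a b : ℝ} {F g g' : ℝ → ℝ} {T : 𝓓'(openInterval a b, ℝ)}

lemma IsPrimitive.hasCPIntegralMul (hF : IsPrimitive F T)
    (hg : ∀ x ∈ Icc a b, HasDerivWithinAt g (g' x) (Icc a b) x) (hg' : ContinuousOn g' (Icc a b)) :
    HasCPIntegralMul T g (F b * g b - ∫ x in a..b, F x * g' x) :=
  ⟨F, hF, _, hasRSIntegral_of_hasDerivWithinAt hF.1 hg hg', by rw [hF.2.1]; ring⟩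

lemma HasCPIntegralMul.unique {I J : ℝ} (hab : a < b) (hI : HasCPIntegralMul T g I)
    (hJ : HasCPIntegralMul T g J) : I = J := by
  obtain ⟨F, hF, I', hI', rfl⟩ := hI
  obtain ⟨G, hG, J', hJ', rfl⟩ := hJ
  have hFG : EqOn F G (Icc a b) := hF.eqOn hab hG
  rw [hI'.unique_of_eqOn hab.le hJ' hFG, hFG (left_mem_Icc.mpr hab.le),
    hFG (right_mem_Icc.mpr hab.le)]

lemma HasCPIntegralMul.cpIntegralMul_eq {I : ℝ} (hab : a < b) (hI : HasCPIntegralMul T g I) :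
    cpIntegralMul T g = I := by
  have hex : ∃ I, HasCPIntegralMul T g I := ⟨I, hI⟩
  rw [cpIntegralMul, dif_pos hex]
  exact hex.choose_spec.unique hab hI

lemma IsPrimitive.cpIntegralMul_eq (hab : a < b) (hF : IsPrimitive F T)
    (hg : ∀ x ∈ Icc a b, HasDerivWithinAt g (g' x) (Icc a b) x) (hg' : ContinuousOn g' (Icc a b)) :
    cpIntegralMul T g = F b * g b - ∫ x in a..b, F x * g' x :=
  (hF.hasCPIntegralMul hg hg').cpIntegralMul_eq hab

lemma IsPrimitive.abs_le_alexNorm (hab : a < b) (hF : IsPrimitive F T) {x : ℝ}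
    (hx : x ∈ Icc a b) : |F x| ≤ alexNorm T := by
  rw [hF.alexNorm_eq hab]
  exact le_csSup (isCompact_Icc.image_of_continuousOn hF.1.abs).bddAbove (mem_image_of_mem _ hx)

lemma IsPrimitive.alexNorm_le (hab : a < b) (hF : IsPrimitive F T) {M : ℝ}
    (hM : ∀ x ∈ Icc a b, |F x| ≤ M) : alexNorm T ≤ M := by
  rw [hF.alexNorm_eq hab]
  exact csSup_le ((nonempty_Icc.mpr hab.le).image _) (forall_mem_image.mpr hM)

lemma IsPrimitive.abs_cpIntegralMul_le (hab : a < b) (hF : IsPrimitive F T)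
    (hg : ∀ x ∈ Icc a b, HasDerivWithinAt g (g' x) (Icc a b) x) (hg' : ContinuousOn g' (Icc a b)) :
    |cpIntegralMul T g| ≤ alexNorm T * (|g b| + ∫ x in a..b, |g' x|) := by
  have hFb : |F b| ≤ alexNorm T := hF.abs_le_alexNorm hab (right_mem_Icc.mpr hab.le)
  have hFg : ContinuousOn (fun x => |F x * g' x|) (Icc a b) := (hF.1.mul hg').abs
  have hMg : ContinuousOn (fun x => alexNorm T * |g' x|) (Icc a b) := hg'.abs.const_mul _
  have hint : |∫ x in a..b, F x * g' x| ≤ alexNorm T * ∫ x in a..b, |g' x| := by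
    rw [← intervalIntegral.integral_const_mul]
    refine (intervalIntegral.abs_integral_le_integral_abs hab.le).trans ?_
    refine intervalIntegral.integral_mono_on hab.le (hFg.intervalIntegrable_of_Icc hab.le)
      (hMg.intervalIntegrable_of_Icc hab.le) fun x hx => ?_
    rw [abs_mul]
    gcongr
    exact hF.abs_le_alexNorm hab hx
  calc |cpIntegralMul T g| = |F b * g b - ∫ x in a..b, F x * g' x| := by
        rw [hF.cpIntegralMul_eq hab hg hg']
    _ ≤ |F b| * |g b| + |∫ x in a..b, F x * g' x| := by
        rw [← abs_mul]; exact abs_sub _ _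
    _ ≤ alexNorm T * |g b| + alexNorm T * ∫ x in a..b, |g' x| := by gcongr
    _ = alexNorm T * (|g b| + ∫ x in a..b, |g' x|) := by ring

end ContinuousPrimitiveIntegral

section IntegrationByParts

variable {a b : ℝ} {f : ℝ → ℝ} {n : ℕ}

lemma integral_iteratedDerivWithin_mul_derivative (hab : a < b)
    (hf : ContDiffOn ℝ (n + 1 : ℕ) f (Icc a b)) (p : ℝ[X]) :
    ∫ x in a..b, iteratedDerivWithin n f (Icc a b) x * (derivative p).eval x =
      iteratedDerivWithin n f (Icc a b) b * p.eval b -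
        iteratedDerivWithin n f (Icc a b) a * p.eval a -
      ∫ x in a..b, iteratedDerivWithin (n + 1) f (Icc a b) x * p.eval x := by
  have hunique : UniqueDiffOn ℝ (Icc a b) := uniqueDiffOn_Icc hab
  have hcont : ContinuousOn (iteratedDerivWithin (n + 1) f (Icc a b)) (Icc a b) :=
    hf.continuousOn_iteratedDerivWithin le_rfl hunique
  have hderiv : ∀ x ∈ uIcc a b, HasDerivWithinAt (iteratedDerivWithin n f (Icc a b))
      (iteratedDerivWithin (n + 1) f (Icc a b) x) (uIcc a b) x := by
    rw [uIcc_of_le hab.le, iteratedDerivWithin_succ]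
    exact fun x hx => (hf.differentiableOn_iteratedDerivWithin (m := n)
      (by exact_mod_cast n.lt_succ_self) hunique x hx).hasDerivWithinAt
  exact intervalIntegral.integral_mul_deriv_eq_deriv_mul_of_hasDerivWithinAt hderiv
    (fun x _ => (p.hasDerivAt x).hasDerivWithinAt)
    (hcont.intervalIntegrable_of_Icc hab.le) ((derivative p).continuous.intervalIntegrable _ _)

lemma integral_mul_eval_iterate_derivative_succ (hab : a < b) (hf : ContDiffOn ℝ n f (Icc a b))
    (p : ℝ[X]) :
    ∫ x in a..b, f x * (derivative^[n + 1] p).eval x =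
      ∑ k ∈ Finset.range n, (-1) ^ k *
        (iteratedDerivWithin k f (Icc a b) b * (derivative^[n - k] p).eval b -
          iteratedDerivWithin k f (Icc a b) a * (derivative^[n - k] p).eval a) +
      (-1) ^ n * ∫ x in a..b, iteratedDerivWithin n f (Icc a b) x * (derivative p).eval x := by
  induction n generalizing p with
  | zero => simp
  | succ n ih =>
    have hderiv : ∀ k ∈ Finset.range n,
        derivative^[n - k] (derivative p) = derivative^[n + 1 - k] p := fun k hk => by
      rw [Nat.sub_add_comm (Finset.mem_range.mp hk).le, Function.iterate_succ_apply]
    rw [Function.iterate_succ_apply, ih (hf.of_le (by exact_mod_cast n.le_succ)),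
      integral_iteratedDerivWithin_mul_derivative hab hf, Finset.sum_range_succ,
      Nat.add_sub_cancel_left, Function.iterate_one,
      Finset.sum_congr rfl fun k hk => by rw [hderiv k hk]]
    ring

lemma cpIntegralMul_distDerivFun_eval (hab : a < b) (hf : ContDiffOn ℝ n f (Icc a b)) (p : ℝ[X]) :
    cpIntegralMul (distDerivFun (n + 1) a b f) (fun x => p.eval x) =
      iteratedDerivWithin n f (Icc a b) b * p.eval b -
        iteratedDerivWithin n f (Icc a b) a * p.eval a -
      ∫ x in a..b, iteratedDerivWithin n f (Icc a b) x * (derivative p).eval x := by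
  have hcont : ContinuousOn (fun x => iteratedDerivWithin n f (Icc a b) x * (derivative p).eval x)
      (Icc a b) :=
    (hf.continuousOn_iteratedDerivWithin le_rfl (uniqueDiffOn_Icc hab)).mul
      (derivative p).continuous.continuousOn
  have hp' : IntervalIntegrable (fun x => (derivative p).eval x) volume a b :=
    (derivative p).continuous.intervalIntegrable _ _
  rw [(isPrimitive_distDerivFun hab hf).cpIntegralMul_eq hab (hasDerivWithinAt_eval p)
    (derivative p).continuous.continuousOn]
  simp only [sub_mul]
  rw [intervalIntegral.integral_sub (hcont.intervalIntegrable_of_Icc hab.le) (hp'.const_mul _),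
    intervalIntegral.integral_const_mul,
    intervalIntegral.integral_eq_sub_of_hasDerivAt (fun x _ => p.hasDerivAt x) hp']
  ring

lemma integral_mul_eval_iterate_derivative_eq_add_cpIntegralMul (hab : a < b)
    (hf : ContDiffOn ℝ n f (Icc a b)) (p : ℝ[X]) :
    ∫ x in a..b, f x * (derivative^[n + 1] p).eval x =
      ∑ k ∈ Finset.range (n + 1), (-1) ^ k *
        (iteratedDerivWithin k f (Icc a b) b * (derivative^[n - k] p).eval b -
          iteratedDerivWithin k f (Icc a b) a * (derivative^[n - k] p).eval a) +
      (-1) ^ (n + 1) * cpIntegralMul (distDerivFun (n + 1) a b f) (fun x => p.eval x) := by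
  rw [integral_mul_eval_iterate_derivative_succ hab hf, cpIntegralMul_distDerivFun_eval hab hf,
    Finset.sum_range_succ, Nat.sub_self, Function.iterate_zero_apply]
  ring

end IntegrationByParts

section EndpointDerivatives

variable {R : Type*}

lemma iterate_derivative_eq_C_factorial [Semiring R] {p : R[X]} {n : ℕ}
    (hp : IsMonicOfDegree p n) : derivative^[n] p = C (n ! : R) := by
  ext k
  rw [coeff_iterate_derivative, coeff_C]
  obtain rfl | hk := eq_or_ne k 0
  · rw [zero_add, Nat.descFactorial_self, ← hp.natDegree_eq, coeff_natDegree, hp.leadingCoeff_eq]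
    simp
  · rw [coeff_eq_zero_of_natDegree_lt (by have := hp.natDegree_eq; omega)]
    simp [hk]

lemma iterate_derivative_comp_linear [CommSemiring R] (p : R[X]) (c d : R) (m : ℕ) :
    derivative^[m] (p.comp (C c * X + C d)) =
      C (c ^ m) * (derivative^[m] p).comp (C c * X + C d) := by
  induction m with
  | zero => simp
  | succ m ih =>
    have hlinear : derivative (C c * X + C d) = C c := by simp
    rw [Function.iterate_succ_apply', ih, Function.iterate_succ_apply', derivative_C_mul,
      derivative_comp, hlinear, pow_succ, C_mul, mul_assoc]

lemma T_comp_neg_X [CommRing R] (n : ℕ) :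
    (Chebyshev.T R n).comp (-X) = (-1) ^ n * Chebyshev.T R n := by
  rw [comp_eq_aeval, Chebyshev.aeval_T, Chebyshev.T_eval_neg, ← Chebyshev.aeval_T (R := R),
    aeval_X_left_apply]
  simp

lemma eval_neg_one_iterate_derivative_T [CommRing R] (n m : ℕ) :
    (derivative^[m] (Chebyshev.T R n)).eval (-1) =
      (-1) ^ (n + m) * (derivative^[m] (Chebyshev.T R n)).eval 1 := by
  have hcomp := iterate_derivative_comp_linear (Chebyshev.T R n) (-1) 0 m
  have hreflect : (Chebyshev.T R n).comp (C (-1) * X + C 0) = C ((-1) ^ n) * Chebyshev.T R n := by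
    simpa using T_comp_neg_X n
  rw [hreflect, iterate_derivative_C_mul] at hcomp
  have hone := congrArg (eval 1) hcomp
  simp only [eval_mul, eval_C, eval_comp, eval_add, eval_X, mul_one, add_zero] at hone
  rw [pow_add]
  linear_combination (-(eval (-1) (derivative^[m] (Chebyshev.T R n)))) *
    (Even.neg_one_pow (Even.add_self m) : (-1 : R) ^ (m + m) = 1) - (-1) ^ m * hone

lemma eval_one_iterate_derivative_T_mul_factorial [CommRing R] {n m : ℕ} (hn : n ≠ 0)
    (hm : m ≤ n) :
    (derivative^[m] (Chebyshev.T R n)).eval 1 * ((n - m)! * (2 * m)!) =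
      n * (n + m - 1)! * 2 ^ m * m ! := by
  induction m with
  | zero =>
    simp [← Nat.mul_factorial_pred hn]
  | succ m ih =>
    have hrec := Chebyshev.iterate_derivative_T_eval_one_recurrence (R := R) n m
    obtain ⟨k, rfl⟩ := Nat.exists_eq_add_of_le hm
    have ih := ih (by omega)
    rw [show m + 1 + k - m = k + 1 by omega, show m + 1 + k + m - 1 = 2 * m + k by omega] at ih
    rw [show m + 1 + k - (m + 1) = k by omega,
      show m + 1 + k + (m + 1) - 1 = 2 * m + k + 1 by omega,
      show 2 * (m + 1) = 2 * m + 1 + 1 by omega]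
    simp only [Nat.factorial_succ] at ih ⊢
    push_cast at ih hrec ⊢
    linear_combination ((k ! : R) * (2 * m + 2) * ((2 * m)! : R)) * hrec +
      (2 * m + 2) * (2 * m + 1 + k) * ih

variable {a b : ℝ} {n m : ℕ}

lemma eval_iterate_derivative_minPolyOn (hm : m ≠ 0) (x : ℝ) :
    (derivative^[m] (minPolyOn n a b)).eval x = minPolyScale n a b * (2 / (b - a)) ^ m *
      (derivative^[m] (Chebyshev.T ℝ n)).eval ((rescale a b).eval x) := by
  have hone : derivative^[m] (1 : ℝ[X]) = 0 := iterate_derivative_one (Nat.pos_of_ne_zero hm)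
  rw [minPolyOn_eq, iterate_derivative_C_mul, rescale, iterate_derivative_comp_linear,
    iterate_derivative_sub, hone, sub_zero, eval_C_mul, eval_C_mul, eval_comp, mul_assoc]

lemma eval_left_iterate_derivative_minPolyOn (hm : m ≠ 0) (hab : a ≠ b) :
    (derivative^[m] (minPolyOn n a b)).eval a =
      (-1) ^ (n + m) * (derivative^[m] (minPolyOn n a b)).eval b := by
  rw [eval_iterate_derivative_minPolyOn hm, eval_iterate_derivative_minPolyOn hm,
    eval_rescale_left hab, eval_rescale_right hab, eval_neg_one_iterate_derivative_T]
  ring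

lemma eval_right_iterate_derivative_minPolyOn {k : ℕ} (hm : m ≠ 0) (hab : a ≠ b) :
    (derivative^[m] (minPolyOn (m + k + 1) a b)).eval b / (m + k + 1)! =
      1 / (m + k)! * ((b - a) ^ (k + 1) * (2 * m + k)! * m ! /
        (2 ^ (2 * k + 1) * (2 * m)! * (k + 1)!)) := by
  have : b - a ≠ 0 := sub_ne_zero.mpr hab.symm
  have hT := eval_one_iterate_derivative_T_mul_factorial (R := ℝ) (n := m + k + 1) (m := m)
    (by omega) (by omega)
  rw [show m + k + 1 - m = k + 1 by omega, show m + k + 1 + m - 1 = 2 * m + k by omega,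
    ← eq_div_iff (by positivity)] at hT
  have hfour : (4 : ℝ) ^ (m + k + 1) = 2 ^ (2 * (m + k + 1)) := by rw [pow_mul]; norm_num
  rw [eval_iterate_derivative_minPolyOn hm, eval_rescale_right hab, hT, minPolyScale,
    Nat.factorial_succ (m + k), div_pow, div_pow, hfour]
  push_cast
  field_simp
  ring

end EndpointDerivatives

section Quadrature

variable {a b : ℝ} {f : ℝ → ℝ} {n : ℕ}

lemma two_mul_minPolyScale_succ :
    2 * minPolyScale (n + 1) a b = (b - a) ^ (n + 1) / 2 ^ (2 * n) := by
  have hfour : (4 : ℝ) ^ (n + 1) = 4 * 2 ^ (2 * n) := by rw [pow_mul]; ring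
  rw [minPolyScale, div_pow, hfour]
  ring

lemma boundary_term_minPolyOn {m k : ℕ} (hm : m ≠ 0) (hab : a ≠ b) (u v : ℝ) :
    1 / (m + k + 1)! * ((-1) ^ k * (v * (derivative^[m] (minPolyOn (m + k + 1) a b)).eval b -
        u * (derivative^[m] (minPolyOn (m + k + 1) a b)).eval a)) =
      1 / (m + k)! * ((b - a) ^ (k + 1) * (2 * m + k)! * m ! /
        (2 ^ (2 * k + 1) * (2 * m)! * (k + 1)!) * (u + (-1) ^ k * v)) := by
  have hsign : (-1 : ℝ) ^ (m + k + 1 + m) = -(-1) ^ k := by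
    rw [show m + k + 1 + m = 2 * m + (k + 1) by ring, pow_add, pow_mul, pow_succ (-1) k]
    simp
  have hsq : (-1 : ℝ) ^ (k + k) = 1 := Even.neg_one_pow (Even.add_self k)
  rw [← mul_assoc (1 / ((m + k)! : ℝ)), ← eval_right_iterate_derivative_minPolyOn hm hab,
    eval_left_iterate_derivative_minPolyOn hm hab, hsign]
  linear_combination
    (derivative^[m] (minPolyOn (m + k + 1) a b)).eval b / (m + k + 1)! * u * hsq

lemma last_boundary_term_minPolyOn (hab : a ≠ b) (u v : ℝ) :
    1 / (n + 1)! * ((-1) ^ n *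
        (v * (minPolyOn (n + 1) a b).eval b - u * (minPolyOn (n + 1) a b).eval a)) =
      if Odd (n + 1) then (b - a) ^ (n + 1) * u / ((n + 1)! * 2 ^ (2 * n)) else 0 := by
  rw [eval_minPolyOn_right hab, eval_minPolyOn_left hab]
  split_ifs with hodd
  · have heven : Even n := by simpa [Nat.even_add_one] using Nat.not_even_iff_odd.mpr hodd
    have hscale : minPolyScale (n + 1) a b * ((-1) ^ (n + 1) - 1) =
        -((b - a) ^ (n + 1) / 2 ^ (2 * n)) := by
      rw [← two_mul_minPolyScale_succ, hodd.neg_one_pow]; ring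
    rw [heven.neg_one_pow, hscale]
    field_simp
    ring
  · rw [(Nat.not_odd_iff_even.mp hodd).neg_one_pow]
    simp

lemma quadRule_eq_sum_boundary (hab : a ≠ b) :
    quadRule (n + 1) a b f = 1 / (n + 1)! * ∑ k ∈ Finset.range (n + 1), (-1) ^ k *
      (iteratedDerivWithin k f (Icc a b) b *
          (derivative^[n - k] (minPolyOn (n + 1) a b)).eval b -
        iteratedDerivWithin k f (Icc a b) a *
          (derivative^[n - k] (minPolyOn (n + 1) a b)).eval a) := by
  rw [quadRule, Finset.sum_range_succ, mul_add (1 / ((n + 1)! : ℝ)), Nat.sub_self,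
    Function.iterate_zero_apply, last_boundary_term_minPolyOn hab, Finset.mul_sum, Finset.mul_sum]
  congr 1
  refine Finset.sum_congr rfl fun k hk => ?_
  obtain ⟨m, rfl⟩ := Nat.exists_eq_add_of_lt (Finset.mem_range.mp hk)
  rw [show k + m + 1 = (m + 1) + k by ring, Nat.add_sub_cancel, Nat.add_sub_cancel,
    show 2 * (m + 1 + k + 1) - k - 2 = 2 * (m + 1) + k by omega,
    show m + 1 + k + 1 - k - 1 = m + 1 by omega,
    show 2 * (m + 1 + k + 1) - 2 * k - 2 = 2 * (m + 1) by omega]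
  exact (boundary_term_minPolyOn m.succ_ne_zero hab _ _).symm

theorem integral_eq_quadRule_add_quadError (hab : a < b) (hf : ContDiffOn ℝ n f (Icc a b)) :
    ∫ x in a..b, f x = quadRule (n + 1) a b f + quadError (n + 1) a b f := by
  have hparts := integral_mul_eval_iterate_derivative_eq_add_cpIntegralMul hab hf
    (minPolyOn (n + 1) a b)
  have hmonic : IsMonicOfDegree (minPolyOn (n + 1) a b) (n + 1) :=
    isMonicOfDegree_minPolyOn n.succ_ne_zero hab.ne
  rw [iterate_derivative_eq_C_factorial hmonic] at hparts
  simp only [eval_C, intervalIntegral.integral_mul_const] at hparts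
  rw [quadRule_eq_sum_boundary hab.ne, quadError]
  field_simp
  exact hparts

end Quadrature

section ErrorEstimate

variable {a b : ℝ} {f : ℝ → ℝ} {n : ℕ}

lemma abs_quadError (n : ℕ) (a b : ℝ) (f : ℝ → ℝ) :
    |quadError n a b f| =
      |cpIntegralMul (distDerivFun n a b f) (fun x => (minPolyOn n a b).eval x)| / n ! := by
  rw [quadError, abs_mul, abs_div, abs_pow, abs_neg, abs_one, one_pow, Nat.abs_cast,
    one_div_mul_eq_div]

lemma integral_abs_derivative_minPolyOn_div_factorial (hab : a < b) :
    (∫ x in a..b, |(derivative (minPolyOn (n + 1) a b)).eval x|) / (n + 1)! =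
      (b - a) ^ (n + 1) / (n ! * 2 ^ (2 * n)) := by
  rw [integral_abs_derivative_minPolyOn n.succ_ne_zero hab, mul_right_comm,
    two_mul_minPolyScale_succ, Nat.factorial_succ]
  push_cast
  field_simp

theorem abs_quadError_le (hab : a < b) (hf : ContDiffOn ℝ n f (Icc a b)) :
    |quadError (n + 1) a b f| ≤
      alexNorm (distDerivFun (n + 1) a b f) * (b - a) ^ (n + 1) / (n ! * 2 ^ (2 * n)) := by
  have hholder := (isPrimitive_distDerivFun hab hf).abs_cpIntegralMul_le hab
    (hasDerivWithinAt_eval (minPolyOn (n + 1) a b)) (derivative _).continuous.continuousOn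
  rw [eval_minPolyOn_right hab.ne, abs_zero, zero_add] at hholder
  rw [abs_quadError, mul_div_assoc, ← integral_abs_derivative_minPolyOn_div_factorial hab,
    ← mul_div_assoc]
  gcongr

lemma alexNorm_nonneg (T : 𝓓'(openInterval a b, ℝ)) : 0 ≤ alexNorm T :=
  Real.sSup_nonneg (forall_mem_image.mpr fun _ _ => abs_nonneg _)

lemma exists_contDiff_iteratedDeriv_eq (n : ℕ) {F : ℝ → ℝ} (hF : Continuous F) :
    ∃ f : ℝ → ℝ, ContDiff ℝ n f ∧ iteratedDeriv n f = F := by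
  induction n with
  | zero => exact ⟨F, contDiff_zero.mpr hF, iteratedDeriv_zero⟩
  | succ n ih =>
    obtain ⟨g, hg, rfl⟩ := ih
    have hderiv (x : ℝ) : HasDerivAt (fun x => ∫ t in (0 : ℝ)..x, g t) (g x) x :=
      hg.continuous.integral_hasStrictDerivAt 0 x |>.hasDerivAt
    have hderiv_eq : deriv (fun x => ∫ t in (0 : ℝ)..x, g t) = g :=
      funext fun x => (hderiv x).deriv
    refine ⟨fun x => ∫ t in (0 : ℝ)..x, g t, ?_, by rw [iteratedDeriv_succ', hderiv_eq]⟩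
    push_cast
    rw [contDiff_succ_iff_deriv, hderiv_eq]
    exact ⟨fun x => (hderiv x).differentiableAt, by simp, hg⟩

lemma exists_lt_abs_quadError (hab : a < b) {r : ℝ}
    (hr : r < (b - a) ^ (n + 1) / (n ! * 2 ^ (2 * n))) :
    ∃ f, ContDiff ℝ n f ∧ alexNorm (distDerivFun (n + 1) a b f) ≤ 1 ∧
      r < |quadError (n + 1) a b f| := by
  rw [← integral_abs_derivative_minPolyOn_div_factorial hab, lt_div_iff₀ (by positivity)] at hr
  obtain ⟨F, hF, hFa, hF_le, hlt⟩ :=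
    exists_continuous_lt_integral_mul hab.le (derivative (minPolyOn (n + 1) a b)).continuous hr
  obtain ⟨f, hf, hfF⟩ := exists_contDiff_iteratedDeriv_eq n hF
  have hderiv : EqOn (iteratedDerivWithin n f (Icc a b)) F (Icc a b) := fun x hx => by
    rw [iteratedDerivWithin_eq_iteratedDeriv (uniqueDiffOn_Icc hab) hf.contDiffAt hx, hfF]
  have hderiv_left : iteratedDerivWithin n f (Icc a b) a = 0 :=
    (hderiv (left_mem_Icc.mpr hab.le)).trans hFa
  refine ⟨f, hf, (isPrimitive_distDerivFun hab hf.contDiffOn).alexNorm_le hab fun x hx => ?_, ?_⟩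
  · rw [hderiv_left, sub_zero, hderiv hx]
    exact hF_le x
  · have hcp : cpIntegralMul (distDerivFun (n + 1) a b f)
        (fun x => (minPolyOn (n + 1) a b).eval x) =
        -∫ x in a..b, F x * (derivative (minPolyOn (n + 1) a b)).eval x := by
      rw [cpIntegralMul_distDerivFun_eval hab hf.contDiffOn, eval_minPolyOn_right hab.ne,
        hderiv_left, mul_zero, zero_mul, sub_zero, zero_sub]
      congr 1
      refine intervalIntegral.integral_congr fun x hx => ?_
      rw [uIcc_of_le hab.le] at hx
      simp only [hderiv hx]
    rw [abs_quadError, lt_div_iff₀ (by positivity), hcp, abs_neg]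
    exact hlt.trans_le (le_abs_self _)

theorem le_of_forall_abs_quadError_le (hab : a < b) {c : ℝ}
    (hc : ∀ f, ContDiffOn ℝ n f (Icc a b) →
      |quadError (n + 1) a b f| ≤ c * alexNorm (distDerivFun (n + 1) a b f)) :
    (b - a) ^ (n + 1) / (n ! * 2 ^ (2 * n)) ≤ c := by
  have : 0 < b - a := sub_pos.mpr hab
  by_contra! hlt
  have hpos : max c 0 < (b - a) ^ (n + 1) / (n ! * 2 ^ (2 * n)) := max_lt hlt (by positivity)
  obtain ⟨f, hf, hnorm, herror⟩ := exists_lt_abs_quadError hab hpos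
  refine herror.not_ge ?_
  calc |quadError (n + 1) a b f| ≤ c * alexNorm (distDerivFun (n + 1) a b f) := hc f hf.contDiffOn
    _ ≤ max c 0 * alexNorm (distDerivFun (n + 1) a b f) := by
        have := alexNorm_nonneg (distDerivFun (n + 1) a b f)
        gcongr
        exact le_max_left c 0
    _ ≤ max c 0 := mul_le_of_le_one_right (le_max_right c 0) hnorm

end ErrorEstimate

theorem holderFactor_minPolyOn_lt {a b : ℝ} {n : ℕ} {p : ℝ[X]} (hn : n ≠ 0) (hab : a < b)
    (hp : IsMonicOfDegree p n) (hne : p ≠ minPolyOn n a b) :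
    holderFactor a b (minPolyOn n a b) < holderFactor a b p := by
  refine lt_of_not_ge fun hle => hne (eq_minPolyOn_of_add_integral_abs_le hn hab hp ?_)
  have hnonneg : 0 ≤ ∫ x in a..b, |(derivative (minPolyOn n a b)).eval x| :=
    intervalIntegral.integral_nonneg hab.le fun _ _ => abs_nonneg _
  rwa [holderFactor_eq hab.le, holderFactor_eq hab.le, eval_minPolyOn_right hab.ne, abs_zero,
    zero_add, ENNReal.ofReal_le_ofReal_iff hnonneg] at hle

end CPI

end

theorem mainTheorem3 (n : ℕ) (hn : 1 ≤ n) (a b : ℝ) (hab : a < b) :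
    -- the polynomial `φ_n` is the unique minimizer of `|p(b)| + Vp` among the monic
    -- polynomials of degree `n`
    ((CPI.minPolyOn n a b).Monic ∧ (CPI.minPolyOn n a b).natDegree = n ∧
      ∀ p : Polynomial ℝ, p.Monic → p.natDegree = n → p ≠ CPI.minPolyOn n a b →
        CPI.holderFactor a b (CPI.minPolyOn n a b) < CPI.holderFactor a b p) ∧
    -- integrability, the quadrature formula and the error estimate
    (∀ f : ℝ → ℝ, ContDiffOn ℝ ((n - 1 : ℕ) : WithTop ℕ∞) f (Set.Icc a b) →
      CPI.distDerivFun n a b f ∈ CPI.Ac a b ∧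
      (∃ I : ℝ, CPI.HasCPIntegralMul (CPI.distDerivFun n a b f)
        (fun x => (CPI.minPolyOn n a b).eval x) I) ∧
      ∫ x in a..b, f x = CPI.quadRule n a b f + CPI.quadError n a b f ∧
      |CPI.quadError n a b f| ≤
        CPI.alexNorm (CPI.distDerivFun n a b f) * (b - a) ^ n /
          ((Nat.factorial (n - 1) : ℝ) * 2 ^ (2 * n - 2))) ∧
    -- sharpness of the coefficient
    (∀ c : ℝ,
      (∀ f : ℝ → ℝ, ContDiffOn ℝ ((n - 1 : ℕ) : WithTop ℕ∞) f (Set.Icc a b) →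
        |CPI.quadError n a b f| ≤ c * CPI.alexNorm (CPI.distDerivFun n a b f)) →
      (b - a) ^ n / ((Nat.factorial (n - 1) : ℝ) * 2 ^ (2 * n - 2)) ≤ c) := by
  obtain ⟨m, rfl⟩ := Nat.exists_eq_add_of_le' hn
  have hmonic := CPI.isMonicOfDegree_minPolyOn m.succ_ne_zero hab.ne
  refine ⟨⟨hmonic.monic, hmonic.natDegree_eq, fun p hp hdeg hne =>
    CPI.holderFactor_minPolyOn_lt m.succ_ne_zero hab ⟨hdeg, hp⟩ hne⟩, fun f hf => ?_,
    fun c hc => CPI.le_of_forall_abs_quadError_le hab hc⟩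
  have hprim := CPI.isPrimitive_distDerivFun hab hf
  exact ⟨⟨_, hprim⟩,
    ⟨_, hprim.hasCPIntegralMul (CPI.hasDerivWithinAt_eval _) (Polynomial.continuousOn _)⟩,
    CPI.integral_eq_quadRule_add_quadError hab hf, CPI.abs_quadError_le hab hf⟩
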